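/- Let $R$ be a commutative Noetherian local ring, let $t=\operatorname{depth} R$, and let $M$ be a finitely generated $R$-module. Let $\operatorname{H-dim}_R$ stand for either the projective dimension $\operatorname{pd}_R$ or the Gorenstein dimension $\operatorname{G-dim}_R$ (the infimum of the lengths of resolutions by totally reflexive modules, where a finitely generated module $G$ is totally reflexive if it is reflexive and $\operatorname{Ext}^i_R(G,R)=\operatorname{Ext}^i_R(\operatorname{Hom}_R(G,R),R)=0$ for all $i>0$); the zero module has dimension $-\infty$. For an integer $n\ge 0$, the module $M$ is said to satisfy $(\widetilde S_n)$ if $$\operatorname{depth}_{R_{\mathfrak p}}(M_{\mathfrak p})\ \ge\ \min\{n,\operatorname{depth} R_{\mathfrak p}\}$$ for all prime ideals $\mathfrak p$ of $R$, where the zero module has depth $\infty$. 1. Let $n$ be an integer with $0\le n\le t$, and suppose that $M$ satisfies $(\widetilde S_n)$. If $\operatorname{H-dim}_R(\operatorname{Ext}^i_R(M,R))<\infty$ for all $0\le i\le t-n$, then $\operatorname{H-dim}_R(M)\le t-n$. 2. In particular, if $\operatorname{H-dim}_R(\operatorname{Ext}^i_R(M,R))<\infty$ for all $0\le i\le t$,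 then $\operatorname{H-dim}_R(M)<\infty$. -/

import Mathlib

open CategoryTheory CategoryTheory.Abelian

universe u

namespace ExtHomDim

section Depth

variable (R : Type u) [CommRing R] [IsLocalRing R] (M : Type u) [AddCommGroup M] [Module R M]

open Classical in
/-- The depth of a (finitely generated) module `M` over a local ring `R`: the supremum of the
lengths of the `M`-regular sequences in the maximal ideal, with the usual convention that the
zero module has depth `∞`. -/
noncomputable def depth : ℕ∞ :=
  if Subsingleton M then ⊤
  else ⨆ rs ∈ {rs : List R | (∀ r ∈ rs, r ∈ IsLocalRing.maximalIdeal R) ∧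
    RingTheory.Sequence.IsRegular M rs}, (rs.length : ℕ∞)

end Depth

/-- The condition `(S̃ₙ)`: `depth M_𝔭 ≥ min {n, depth R_𝔭}` for all prime ideals `𝔭` of `R`. -/
def SatisfiesSTilde (R : Type u) [CommRing R] (M : Type u) [AddCommGroup M] [Module R M]
    (n : ℕ) : Prop :=
  ∀ (p : Ideal R) [p.IsPrime],
    min (n : ℕ∞) (depth (Localization.AtPrime p) (Localization.AtPrime p)) ≤
      depth (Localization.AtPrime p) (LocalizedModule p.primeCompl M)

section Dimensions

variable {R : Type u} [CommRing R]

/-- The `R`-module `Ext^i_R(M, R)`. -/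
noncomputable abbrev extRing (M : ModuleCat.{u} R) (i : ℕ) : ModuleCat.{u} R :=
  ModuleCat.of R (Ext.{u} M (ModuleCat.of R R) i)

/-- A finitely generated module `G` is totally reflexive if it is reflexive and
`Ext^i_R(G, R) = Ext^i_R(G^*, R) = 0` for all `i > 0`. -/
structure IsTotallyReflexive (G : ModuleCat.{u} R) : Prop where
  finite : Module.Finite R G
  reflexive : Module.IsReflexive R G
  ext_eq_zero : ∀ i : ℕ, 0 < i → Subsingleton (extRing G i)
  ext_dual_eq_zero : ∀ i : ℕ, 0 < i →
    Subsingleton (extRing (ModuleCat.of R (Module.Dual R G)) i)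

/-- A resolution `⋯ → G₂ → G₁ → G₀ → M → 0` of `M` by totally reflexive modules. -/
structure TotallyReflexiveResolution (M : ModuleCat.{u} R) where
  G : ℕ → ModuleCat.{u} R
  d : ∀ i : ℕ, G (i + 1) →ₗ[R] G i
  ε : G 0 →ₗ[R] M
  totallyReflexive : ∀ i, IsTotallyReflexive (G i)
  exact_succ : ∀ i, Function.Exact (d (i + 1)) (d i)
  exact_zero : Function.Exact (d 0) ε
  surjective : Function.Surjective ε

/-- The length `sup {i : Gᵢ ≠ 0}` of a resolution, which is `⊥` (for `-∞`) if all `Gᵢ` vanish. -/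
noncomputable def TotallyReflexiveResolution.length {M : ModuleCat.{u} R}
    (P : TotallyReflexiveResolution M) : WithBot ℕ∞ :=
  sSup {l : WithBot ℕ∞ | ∃ i : ℕ, Nontrivial (P.G i) ∧ l = ((i : ℕ∞) : WithBot ℕ∞)}

/-- The Gorenstein dimension: the infimum of the lengths of the resolutions of `M` by totally
reflexive modules. As with `projectiveDimension`, its value is `⊥` exactly for the zero module. -/
noncomputable def gorensteinDimension (M : ModuleCat.{u} R) : WithBot ℕ∞ :=
  ⨅ P : TotallyReflexiveResolution M, P.length

/-- The two homological dimensions that `H-dim` can stand for. -/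
inductive HomDimKind
  | projective
  | gorenstein

/-- `H-dim_R M`, that is, `pd_R M` or `G-dim_R M`. -/
noncomputable def hDim (H : HomDimKind) (M : ModuleCat.{u} R) : WithBot ℕ∞ :=
  match H with
  | .projective => projectiveDimension M
  | .gorenstein => gorensteinDimension M

end Dimensions

end ExtHomDim

/-!
Let `t = depth R` and `s = t - n`. The proof is an induction on `s` in which the depth condition is
used only through its cohomological form `ExtSTilde`: `Ext^l_R(R/𝔭, M_𝔭) = 0` for `l < n` and
`l < depth R_𝔭`.

If `s > 0`, the first syzygy `K` of `M` satisfies the condition for `n + 1`. Its dual is an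
extension of `Ext^1(M, R)` by the cokernel of `M^* → F^*`, with `F` free, and
`Ext^{i+1}(K, R) ≅ Ext^{i+2}(M, R)`, so the hypotheses pass to `K`.

If `s = 0`, only `H-dim M^* < ∞` is given. A presentation `F₁ → F₀ → M → 0` yields an exact
sequence `0 → M^* → F₀^* → F₁^* → C → 0`, so the transpose `C` of `M` has finite dimension. The
point is that `Ext^j(C, R) = 0` for all `j > 0` (`extVanish_transpose`). Otherwise take `j` least
with `Ext^j(C, R) ≠ 0` and an associated prime `𝔭` of this module. The Auslander–Bridger inequality
`GDimLE.extVanish_of_length_lt`, over `R` and over `R_𝔭`, bounds `j` by `t` and by `depth R_𝔭`.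
Since `M` is the transpose of `C`, shifting along the dual of a free resolution of `C` shows that
`𝔭` can only be associated to `Ext^j(C, R)` if some `Ext^l(R/𝔭, -)` with `l < j` is nonzero on `M_𝔭`
or on `R_𝔭` (`notMem_associatedPrimes_ext`), against the depth condition. So `C` is totally
reflexive, hence so are `M^*` and `M`; if moreover `M^*` has finite projective dimension, it is
projective, and so is `M ≅ M^{**}`.

The Auslander–Bridger inequality is proved for a localization `S` of `R` without localizing `Ext`:
everything is phrased in terms of `Ext_R(X, S)`. A module `X` of finite Gorenstein dimension with
`Ext^j(X, S) = 0` for all `j > 0` is totally reflexive relative to `S` (`IsRelTotallyReflexive`).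
For a maximal regular sequence `rs` of `S`, of length `r`, the `r`-th and later syzygies of a module
have base changes to `S` on which `rs` is regular. If `rs` is regular on the base change of `X`, and
the first syzygy `L ⊆ F` of `X` is relatively totally reflexive, then every map from the cokernel of
`F^* → L^*` to `S/(rs)` is zero, so this cokernel vanishes over `S` by maximality of `rs`, and
`Ext^1(X, S) = 0` (`extVanish_one_of_isMaximalRegular`).
-/

namespace ExtHomDim

/-! ### Vanishing of `Ext` for unbundled modules -/

section ExtToolkit

variable (R : Type u) [CommRing R]

/-- `Ext^n_R(X, Y) = 0`, for unbundled modules. -/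
def ExtVanish (X Y : Type u) [AddCommGroup X] [Module R X] [AddCommGroup Y] [Module R Y]
    (n : ℕ) : Prop :=
  Subsingleton (Ext.{u} (ModuleCat.of R X) (ModuleCat.of R Y) n)

variable {R}
variable {X X' Y Y' A B C : Type u} [AddCommGroup X] [Module R X] [AddCommGroup X'] [Module R X']
  [AddCommGroup Y] [Module R Y] [AddCommGroup Y'] [Module R Y']
  [AddCommGroup A] [Module R A] [AddCommGroup B] [Module R B] [AddCommGroup C] [Module R C]

lemma extVanish_iff {n : ℕ} :
    ExtVanish R X Y n ↔ ∀ e : Ext.{u} (ModuleCat.of R X) (ModuleCat.of R Y) n, e = 0 :=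
  ⟨fun h _ => h.elim _ _, fun h => ⟨fun a b => (h a).trans (h b).symm⟩⟩

/-- The short complex of modules attached to a short exact sequence of linear maps. -/
abbrev sesComplex (f : A →ₗ[R] B) (g : B →ₗ[R] C) (h : Function.Exact f g) :
    ShortComplex (ModuleCat.{u} R) :=
  ModuleCat.shortComplexOfCompEqZero f g h.linearMap_comp_eq_zero

lemma sesComplex_shortExact {f : A →ₗ[R] B} {g : B →ₗ[R] C} (hf : Function.Injective f)
    (h : Function.Exact f g) (hg : Function.Surjective g) : (sesComplex f g h).ShortExact where
  exact := ModuleCat.shortComplex_exact _ h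
  mono_f := (ModuleCat.mono_iff_injective _).2 hf
  epi_g := (ModuleCat.epi_iff_surjective _).2 hg

lemma ExtVanish.of_equiv_left (e : X ≃ₗ[R] X') {n : ℕ} (h : ExtVanish R X Y n) :
    ExtVanish R X' Y n := by
  rw [extVanish_iff] at h ⊢
  intro x
  have : (Ext.mk₀ (e.symm.toModuleIso.hom)).comp
      ((Ext.mk₀ e.toModuleIso.hom).comp x (zero_add n)) (zero_add n) = x := by
    rw [Ext.mk₀_comp_mk₀_assoc]
    have : e.symm.toModuleIso.hom ≫ e.toModuleIso.hom = 𝟙 _ := by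
      ext; simp
    rw [this, Ext.mk₀_id_comp]
  rw [h ((Ext.mk₀ e.toModuleIso.hom).comp x (zero_add n)), Ext.comp_zero] at this
  exact this.symm

lemma ExtVanish.of_equiv_right (e : Y ≃ₗ[R] Y') {n : ℕ} (h : ExtVanish R X Y n) :
    ExtVanish R X Y' n := by
  rw [extVanish_iff] at h ⊢
  intro x
  have : (x.comp (Ext.mk₀ e.symm.toModuleIso.hom) (add_zero n)).comp
      (Ext.mk₀ (e.toModuleIso.hom)) (add_zero n) = x := by
    rw [Ext.comp_assoc_of_third_deg_zero, Ext.mk₀_comp_mk₀]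
    have : e.symm.toModuleIso.hom ≫ e.toModuleIso.hom = 𝟙 _ := by
      ext; simp
    rw [this, Ext.comp_mk₀_id]
  rw [h (x.comp (Ext.mk₀ e.symm.toModuleIso.hom) (add_zero n)), Ext.zero_comp] at this
  exact this.symm

lemma extVanish_of_projective [Module.Projective R X] (n : ℕ) : ExtVanish R X Y (n + 1) := by
  have : Projective (ModuleCat.of R X) := (IsProjective.iff_projective X).1 inferInstance
  exact extVanish_iff.2 fun e => e.eq_zero_of_projective

lemma extVanish_of_subsingleton_right [Subsingleton Y] (n : ℕ) : ExtVanish R X Y n := by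
  rw [extVanish_iff]
  intro e
  have : 𝟙 (ModuleCat.of R Y) = 0 := by
    ext x
    exact Subsingleton.elim (α := Y) _ _
  rw [← e.comp_mk₀_id, this, Ext.mk₀_zero, Ext.comp_zero]

lemma extVanish_zero_iff : ExtVanish R X Y 0 ↔ ∀ f : X →ₗ[R] Y, f = 0 := by
  rw [extVanish_iff]
  constructor
  · intro h f
    have := h (Ext.mk₀ (ModuleCat.ofHom f))
    rw [Ext.mk₀_eq_zero_iff] at this
    simpa using congrArg ModuleCat.Hom.hom this
  · intro h e
    obtain ⟨g, rfl⟩ := (Ext.mk₀_bijective _ _).2 e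
    rw [Ext.mk₀_eq_zero_iff]
    ext1
    exact h g.hom

section LES

variable {f : A →ₗ[R] B} {g : B →ₗ[R] C} (hf : Function.Injective f)
    (h : Function.Exact f g) (hg : Function.Surjective g)
include hf h hg

lemma ExtVanish.middle_left {n : ℕ} (hA : ExtVanish R A Y n) (hC : ExtVanish R C Y n) :
    ExtVanish R B Y n := by
  rw [extVanish_iff] at *
  intro e
  obtain ⟨x, rfl⟩ := Ext.contravariant_sequence_exact₂ (sesComplex_shortExact hf h hg) _ e (hA _)
  rw [hC x, Ext.comp_zero]

lemma ExtVanish.sub_left {n : ℕ} (hB : ExtVanish R B Y n) (hC : ExtVanish R C Y (n + 1)) :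
    ExtVanish R A Y n := by
  rw [extVanish_iff] at *
  intro e
  obtain ⟨x, rfl⟩ := Ext.contravariant_sequence_exact₁ (sesComplex_shortExact hf h hg) _ e
    (add_comm 1 n) (hC _)
  rw [hB x, Ext.comp_zero]

lemma ExtVanish.quot_left {n : ℕ} (hA : ExtVanish R A Y n) (hB : ExtVanish R B Y (n + 1)) :
    ExtVanish R C Y (n + 1) := by
  rw [extVanish_iff] at *
  intro e
  obtain ⟨x, rfl⟩ := Ext.contravariant_sequence_exact₃ (sesComplex_shortExact hf h hg) _ e
    (hB _) (add_comm 1 n)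
  rw [hA x, Ext.comp_zero]

lemma ExtVanish.middle_right {n : ℕ} (hA : ExtVanish R X A n) (hC : ExtVanish R X C n) :
    ExtVanish R X B n := by
  rw [extVanish_iff] at *
  intro e
  obtain ⟨x, rfl⟩ := Ext.covariant_sequence_exact₂ _ (sesComplex_shortExact hf h hg) e (hC _)
  rw [hA x, Ext.zero_comp]

lemma ExtVanish.sub_right {n : ℕ} (hC : ExtVanish R X C n) (hB : ExtVanish R X B (n + 1)) :
    ExtVanish R X A (n + 1) := by
  rw [extVanish_iff] at *
  intro e
  obtain ⟨x, rfl⟩ := Ext.covariant_sequence_exact₁ _ (sesComplex_shortExact hf h hg) e (hB _) rfl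
  rw [hC x, Ext.zero_comp]

lemma ExtVanish.quot_right {n : ℕ} (hB : ExtVanish R X B n) (hA : ExtVanish R X A (n + 1)) :
    ExtVanish R X C n := by
  rw [extVanish_iff] at *
  intro e
  obtain ⟨x, rfl⟩ := Ext.covariant_sequence_exact₃ _ (sesComplex_shortExact hf h hg) e rfl (hA _)
  rw [hB x, Ext.zero_comp]

/-- If `Ext^1(C, Y) = 0`, then maps to `Y` extend along `A → B`. -/
lemma ExtVanish.exists_extension (hC : ExtVanish R C Y 1) (φ : A →ₗ[R] Y) :
    ∃ ψ : B →ₗ[R] Y, ψ ∘ₗ f = φ := by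
  rw [extVanish_iff] at *
  obtain ⟨x, hx⟩ := Ext.contravariant_sequence_exact₁ (sesComplex_shortExact hf h hg)
    (ModuleCat.of R Y) (Ext.mk₀ (ModuleCat.ofHom φ)) (add_zero 1) (hC _)
  obtain ⟨ψ, rfl⟩ := (Ext.mk₀_bijective _ _).2 x
  rw [Ext.mk₀_comp_mk₀] at hx
  have := (Ext.mk₀_bijective _ _).1 hx
  exact ⟨ψ.hom, by simpa using congrArg ModuleCat.Hom.hom this⟩

/-- If `Ext^1(B, Y) = 0` and all maps to `Y` extend along `A → B`, then `Ext^1(C, Y) = 0`. -/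
lemma extVanish_one_of_extension (hB : ExtVanish R B Y 1)
    (H : ∀ φ : A →ₗ[R] Y, ∃ ψ : B →ₗ[R] Y, ψ ∘ₗ f = φ) : ExtVanish R C Y 1 := by
  rw [extVanish_iff] at *
  intro e
  obtain ⟨x, rfl⟩ := Ext.contravariant_sequence_exact₃ (sesComplex_shortExact hf h hg) _ e
    (hB _) (add_zero 1)
  obtain ⟨φ, rfl⟩ := (Ext.mk₀_bijective _ _).2 x
  obtain ⟨ψ, hψ⟩ := H φ.hom
  have : φ = (sesComplex f g h).f ≫ ModuleCat.ofHom ψ := by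
    ext1
    simpa using hψ.symm
  rw [this, ← Ext.mk₀_comp_mk₀, ShortComplex.ShortExact.extClass_comp_assoc]

/-- If `Ext^1(X, A) = 0`, then maps from `X` lift along `B → C`. -/
lemma ExtVanish.exists_lift (hA : ExtVanish R X A 1) (φ : X →ₗ[R] C) :
    ∃ ψ : X →ₗ[R] B, g ∘ₗ ψ = φ := by
  rw [extVanish_iff] at *
  obtain ⟨x, hx⟩ := Ext.covariant_sequence_exact₃ (ModuleCat.of R X)
    (sesComplex_shortExact hf h hg) (Ext.mk₀ (ModuleCat.ofHom φ)) (zero_add 1) (hA _)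
  obtain ⟨ψ, rfl⟩ := (Ext.mk₀_bijective _ _).2 x
  rw [Ext.mk₀_comp_mk₀] at hx
  have := (Ext.mk₀_bijective _ _).1 hx
  exact ⟨ψ.hom, by simpa using congrArg ModuleCat.Hom.hom this⟩

/-- Dimension shifting: `Ext^{n+1}(A, Y) ≃ Ext^{n+2}(C, Y)` if `B` is projective. -/
noncomputable def extShift [Module.Projective R B] (n : ℕ) :
    Ext.{u} (ModuleCat.of R A) (ModuleCat.of R Y) (n + 1) ≃ₗ[R]
      Ext.{u} (ModuleCat.of R C) (ModuleCat.of R Y) (n + 2) := by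
  have hS := sesComplex_shortExact hf h hg
  have : Projective (sesComplex f g h).X₂ :=
    (IsProjective.iff_projective B).1 inferInstance
  refine LinearEquiv.ofBijective (hS.extClass.precompOfLinear R (ModuleCat.of R Y)
    (add_comm 1 (n + 1))) ⟨?_, ?_⟩
  · rw [← LinearMap.ker_eq_bot, LinearMap.ker_eq_bot']
    intro x hx
    obtain ⟨y, rfl⟩ := Ext.contravariant_sequence_exact₁ hS _ x (add_comm 1 (n + 1)) hx
    rw [y.eq_zero_of_projective, Ext.comp_zero]
  · intro x
    exact Ext.contravariant_sequence_exact₃ hS _ x (Ext.eq_zero_of_projective _)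
      (add_comm 1 (n + 1))

/-- For `B` projective, `Ext^1(C, Y)` is the cokernel of `Hom(B, Y) → Hom(A, Y)`. -/
lemma exists_exact_ext_one [Module.Projective R B] :
    ∃ δ : (A →ₗ[R] Y) →ₗ[R] Ext.{u} (ModuleCat.of R C) (ModuleCat.of R Y) 1,
      Function.Surjective δ ∧ ∀ φ, δ φ = 0 ↔ ∃ ψ : B →ₗ[R] Y, ψ ∘ₗ f = φ := by
  have hS := sesComplex_shortExact hf h hg
  have : Projective (sesComplex f g h).X₂ :=
    (IsProjective.iff_projective B).1 inferInstance
  let e : (A →ₗ[R] Y) ≃ₗ[R] Ext.{u} (ModuleCat.of R A) (ModuleCat.of R Y) 0 :=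
    (Ext.linearEquiv₀.trans ModuleCat.homLinearEquiv).symm
  have he : ∀ φ, e φ = Ext.mk₀ (ModuleCat.ofHom φ) := fun φ => rfl
  refine ⟨(hS.extClass.precompOfLinear R (ModuleCat.of R Y) (add_zero 1)) ∘ₗ e.toLinearMap,
    ?_, ?_⟩
  · refine Function.Surjective.comp (g := hS.extClass.precompOfLinear R (ModuleCat.of R Y)
      (add_zero 1)) ?_ e.surjective
    intro x
    exact Ext.contravariant_sequence_exact₃ hS _ x (Ext.eq_zero_of_projective _) (add_zero 1)
  · intro φ
    change hS.extClass.comp (e φ) (add_zero 1) = 0 ↔ _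
    rw [he]
    constructor
    · intro hφ
      obtain ⟨x, hx⟩ := Ext.contravariant_sequence_exact₁ hS _ _ (add_zero 1) hφ
      obtain ⟨ψ, rfl⟩ := (Ext.mk₀_bijective _ _).2 x
      rw [Ext.mk₀_comp_mk₀] at hx
      have := (Ext.mk₀_bijective _ _).1 hx
      exact ⟨ψ.hom, by simpa using congrArg ModuleCat.Hom.hom this⟩
    · rintro ⟨ψ, rfl⟩
      have : ModuleCat.ofHom (ψ ∘ₗ f) = (sesComplex f g h).f ≫ ModuleCat.ofHom ψ := rfl
      rw [this, ← Ext.mk₀_comp_mk₀, ShortComplex.ShortExact.extClass_comp_assoc]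

lemma extVanish_shift_iff [Module.Projective R B] (n : ℕ) :
    ExtVanish R A Y (n + 1) ↔ ExtVanish R C Y (n + 2) :=
  (extShift hf h hg (Y := Y) n).toEquiv.subsingleton_congr

end LES

/-- If `r` annihilates `X` and acts bijectively on `Y`, then all `Ext^n(X, Y)` vanish. -/
lemma extVanish_of_smul_eq_zero_of_bijective {r : R} (hX : ∀ x : X, r • x = 0)
    (hY : Function.Bijective fun y : Y => r • y) (n : ℕ) : ExtVanish R X Y n := by
  rw [extVanish_iff]
  intro e
  let E : Y ≃ₗ[R] Y := LinearEquiv.ofBijective (LinearMap.lsmul R Y r) hY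
  have h1 : E.toModuleIso.hom = r • 𝟙 (ModuleCat.of R Y) := by ext; rfl
  have h2 : r • 𝟙 (ModuleCat.of R X) = 0 := by
    ext x
    exact hX x
  have h3 : e.comp (Ext.mk₀ E.toModuleIso.hom) (add_zero n) = 0 := by
    rw [h1, Ext.mk₀_smul, Ext.comp_smul, Ext.comp_mk₀_id]
    conv_lhs => rw [← e.mk₀_id_comp]
    rw [← Ext.smul_comp, ← Ext.mk₀_smul, h2, Ext.mk₀_zero, Ext.zero_comp]
  have : (e.comp (Ext.mk₀ E.toModuleIso.hom) (add_zero n)).comp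
      (Ext.mk₀ (E.toModuleIso.inv)) (add_zero n) = e := by
    rw [Ext.comp_assoc_of_third_deg_zero, Ext.mk₀_comp_mk₀, Iso.hom_inv_id, Ext.comp_mk₀_id]
  rw [← this, h3, Ext.zero_comp]

/-- Suppose that `0 → Y → Y → C → 0` is exact, where the endomorphism `μ` of `Y` becomes, up to
an automorphism of `Y`, multiplication by an element annihilating `X`. Then `μ` induces zero on
`Ext(X, Y)`, and so vanishing passes from `C` to `Y` with a shift by one. -/
lemma ExtVanish.of_quot_right {μ : Y →ₗ[R] Y} {g : Y →ₗ[R] C} (hμ : Function.Injective μ)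
    (h : Function.Exact μ g) (hg : Function.Surjective g) {r : R} (hX : ∀ x : X, r • x = 0)
    (ν : Y →ₗ[R] Y) (hν : Function.Injective ν) (hνs : Function.Surjective ν)
    (hνμ : ∀ y, ν (μ y) = r • y) {n : ℕ} (hC : ExtVanish R X C n) :
    ExtVanish R X Y (n + 1) := by
  rw [extVanish_iff] at hC ⊢
  intro e
  let E : Y ≃ₗ[R] Y := LinearEquiv.ofBijective ν ⟨hν, hνs⟩
  have h1 : ModuleCat.ofHom μ ≫ E.toModuleIso.hom = r • 𝟙 (ModuleCat.of R Y) := by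
    ext y
    exact hνμ y
  have h2 : r • 𝟙 (ModuleCat.of R X) = 0 := by
    ext x
    exact hX x
  have h3 : (e.comp (Ext.mk₀ (ModuleCat.ofHom μ)) (add_zero _)).comp
      (Ext.mk₀ E.toModuleIso.hom) (add_zero _) = 0 := by
    rw [Ext.comp_assoc_of_third_deg_zero, Ext.mk₀_comp_mk₀, h1, Ext.mk₀_smul, Ext.comp_smul,
      Ext.comp_mk₀_id]
    conv_lhs => rw [← e.mk₀_id_comp]
    rw [← Ext.smul_comp, ← Ext.mk₀_smul, h2, Ext.mk₀_zero, Ext.zero_comp]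
  have h4 : e.comp (Ext.mk₀ (ModuleCat.ofHom μ)) (add_zero _) = 0 := by
    rw [← Ext.comp_mk₀_id (e.comp (Ext.mk₀ (ModuleCat.ofHom μ)) (add_zero _)),
      ← E.toModuleIso.hom_inv_id, ← Ext.mk₀_comp_mk₀, ← Ext.comp_assoc_of_third_deg_zero, h3,
      Ext.zero_comp]
  obtain ⟨x, rfl⟩ := Ext.covariant_sequence_exact₁ _ (sesComplex_shortExact hμ h hg) e h4 rfl
  rw [hC x, Ext.zero_comp]

/-- `Ext` into a finite power of a module vanishes if `Ext` into the module does. -/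
lemma ExtVanish.pi_right {n : ℕ} (h : ExtVanish R X Y n) (k : ℕ) :
    ExtVanish R X (Fin k → Y) n := by
  induction k with
  | zero => exact extVanish_of_subsingleton_right n
  | succ k ih =>
    refine (ExtVanish.middle_right (f := LinearMap.inl R Y (Fin k → Y))
      (g := LinearMap.snd R Y (Fin k → Y)) LinearMap.inl_injective ?_
      LinearMap.snd_surjective h ih).of_equiv_right (Fin.consLinearEquiv R (fun _ => Y))
    exact LinearMap.exact_iff.2 (LinearMap.range_inl R Y (Fin k → Y)).symm

end ExtToolkit

/-! ### Totally reflexive modules -/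

section TotallyReflexive

variable {R : Type u} [CommRing R]
variable {A B C : Type u} [AddCommGroup A] [Module R A] [AddCommGroup B] [Module R B]
  [AddCommGroup C] [Module R C]

lemma isTotallyReflexive_iff : IsTotallyReflexive (ModuleCat.of R A) ↔
    Module.Finite R A ∧ Function.Bijective (Module.Dual.eval R A) ∧
      (∀ n, ExtVanish R A R (n + 1)) ∧ ∀ n, ExtVanish R (Module.Dual R A) R (n + 1) := by
  constructor
  · rintro ⟨h1, h2, h3, h4⟩
    exact ⟨h1, h2.bijective_dual_eval', fun n => h3 (n + 1) n.succ_pos,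
      fun n => h4 (n + 1) n.succ_pos⟩
  · rintro ⟨h1, h2, h3, h4⟩
    refine ⟨h1, ⟨h2⟩, fun i hi => ?_, fun i hi => ?_⟩
    · obtain ⟨n, rfl⟩ := Nat.exists_eq_succ_of_ne_zero hi.ne'
      exact h3 n
    · obtain ⟨n, rfl⟩ := Nat.exists_eq_succ_of_ne_zero hi.ne'
      exact h4 n

lemma isTotallyReflexive_of_projective [Module.Finite R A] [Module.Projective R A] :
    IsTotallyReflexive (ModuleCat.of R A) :=
  isTotallyReflexive_iff.2 ⟨inferInstance, Module.bijective_dual_eval R A,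
    fun n => extVanish_of_projective n, fun n => extVanish_of_projective n⟩

lemma IsTotallyReflexive.of_equiv (e : A ≃ₗ[R] B)
    (h : IsTotallyReflexive (ModuleCat.of R A)) : IsTotallyReflexive (ModuleCat.of R B) := by
  obtain ⟨h1, h2, h3, h4⟩ := isTotallyReflexive_iff.1 h
  have : Module.IsReflexive R A := ⟨h2⟩
  have : Module.IsReflexive R B := Module.equiv e
  exact isTotallyReflexive_iff.2 ⟨Module.Finite.equiv e, Module.bijective_dual_eval R B,
    fun n => (h3 n).of_equiv_left e, fun n => (h4 n).of_equiv_left e.symm.dualMap⟩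

lemma exact_dualMap {f : A →ₗ[R] B} {g : B →ₗ[R] C} (h : Function.Exact f g)
    (hg : Function.Surjective g) : Function.Exact g.dualMap f.dualMap :=
  LinearMap.exact_lcomp_of_exact_of_surjective (N := R) h hg

section

variable {f : A →ₗ[R] B} {g : B →ₗ[R] C} (hf : Function.Injective f)
    (h : Function.Exact f g) (hg : Function.Surjective g)
include hf h hg

lemma dualMap_surjective_of_extVanish (hC : ExtVanish R C R 1) :
    Function.Surjective f.dualMap := fun φ => hC.exists_extension hf h hg φ

lemma IsTotallyReflexive.extension (hA : IsTotallyReflexive (ModuleCat.of R A))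
    (hC : IsTotallyReflexive (ModuleCat.of R C)) : IsTotallyReflexive (ModuleCat.of R B) := by
  obtain ⟨a1, a2, a3, a4⟩ := isTotallyReflexive_iff.1 hA
  obtain ⟨c1, c2, c3, c4⟩ := isTotallyReflexive_iff.1 hC
  have s := dualMap_surjective_of_extVanish hf h hg (c3 0)
  have i := LinearMap.dualMap_injective_of_surjective hg
  have ii := LinearMap.dualMap_injective_of_surjective s
  have e := exact_dualMap h hg
  have ee := exact_dualMap e s
  refine isTotallyReflexive_iff.2 ⟨?_, ⟨?_, ?_⟩, fun n => (a3 n).middle_left hf h hg (c3 n),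
    fun n => (c4 n).middle_left i e s (a4 n)⟩
  · have := Module.Finite.equiv ((LinearEquiv.ofInjective f hf).trans
      (LinearEquiv.ofEq _ _ (LinearMap.exact_iff.1 h).symm))
    have := Module.Finite.equiv (g.quotKerEquivOfSurjective hg).symm
    exact Module.Finite.of_submodule_quotient (LinearMap.ker g)
  · rw [← LinearMap.ker_eq_bot, LinearMap.ker_eq_bot']
    intro b hb
    have h1 : Module.Dual.eval R C (g b) = g.dualMap.dualMap (Module.Dual.eval R B b) := rfl
    rw [hb, map_zero] at h1
    obtain ⟨a, rfl⟩ := (h b).1 (c2.1 (h1.trans (map_zero _).symm))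
    have h2 : f.dualMap.dualMap (Module.Dual.eval R A a) = 0 := hb
    rw [a2.1 ((ii (h2.trans (map_zero _).symm)).trans (map_zero _).symm), map_zero]
  · intro β
    obtain ⟨c, hc⟩ := c2.2 (g.dualMap.dualMap β)
    obtain ⟨b, rfl⟩ := hg c
    have h1 : g.dualMap.dualMap (β - Module.Dual.eval R B b) = 0 := by
      rw [map_sub, ← hc]
      exact sub_self _
    obtain ⟨α, hα⟩ := (ee _).1 h1
    obtain ⟨a, rfl⟩ := a2.2 α
    refine ⟨f a + b, ?_⟩
    rw [map_add, ← eq_sub_iff_add_eq, ← hα]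
    rfl

lemma IsTotallyReflexive.kernel (hA : Module.Finite R A)
    (hB : IsTotallyReflexive (ModuleCat.of R B)) (hC : IsTotallyReflexive (ModuleCat.of R C)) :
    IsTotallyReflexive (ModuleCat.of R A) := by
  obtain ⟨b1, b2, b3, b4⟩ := isTotallyReflexive_iff.1 hB
  obtain ⟨c1, c2, c3, c4⟩ := isTotallyReflexive_iff.1 hC
  have s := dualMap_surjective_of_extVanish hf h hg (c3 0)
  have i := LinearMap.dualMap_injective_of_surjective hg
  have ii := LinearMap.dualMap_injective_of_surjective s
  have e := exact_dualMap h hg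
  have ee := exact_dualMap e s
  refine isTotallyReflexive_iff.2 ⟨hA, ⟨?_, ?_⟩, fun n => (b3 n).sub_left hf h hg (c3 (n + 1)),
    fun n => ?_⟩
  · intro a a' haa
    apply hf
    apply b2.1
    exact congrArg f.dualMap.dualMap haa
  · intro α
    obtain ⟨b, hb⟩ := b2.2 (f.dualMap.dualMap α)
    have h1 : Module.Dual.eval R C (g b) = 0 := by
      change g.dualMap.dualMap (Module.Dual.eval R B b) = 0
      rw [hb]
      exact (ee _).2 ⟨α, rfl⟩
    obtain ⟨a, rfl⟩ := (h b).1 (c2.1 (h1.trans (map_zero _).symm))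
    exact ⟨a, ii hb⟩
  · obtain _ | n := n
    · refine extVanish_one_of_extension i e s (b4 0) fun φ => ?_
      obtain ⟨c, rfl⟩ := c2.2 φ
      obtain ⟨b, rfl⟩ := hg c
      exact ⟨Module.Dual.eval R B b, rfl⟩
    · exact (c4 n).quot_left i e s (b4 (n + 1))

end

end TotallyReflexive

/-! ### Finite Gorenstein dimension by free covers -/

section GDim

variable {R : Type u} [CommRing R]

/-- `GDimLE m X` says that an `m`-th syzygy of `X`, formed with finite free covers, is totally
reflexive. -/
def GDimLE : ℕ → ModuleCat.{u} R → Prop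
  | 0, X => IsTotallyReflexive X
  | m + 1, X => ∃ (F : ModuleCat.{u} R) (f : F →ₗ[R] X), Module.Free R F ∧ Module.Finite R F ∧
      Function.Surjective f ∧ GDimLE m (ModuleCat.of R (LinearMap.ker f))

variable {A B C : Type u} [AddCommGroup A] [Module R A] [AddCommGroup B] [Module R B]
  [AddCommGroup C] [Module R C]

lemma GDimLE.finite {m : ℕ} {X : ModuleCat.{u} R} (h : GDimLE m X) : Module.Finite R X := by
  cases m with
  | zero => exact IsTotallyReflexive.finite h
  | succ m =>
    obtain ⟨F, f, -, hF, hf, -⟩ := h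
    exact Module.Finite.of_surjective f hf

lemma GDimLE.of_equiv {m : ℕ} (e : A ≃ₗ[R] B) (h : GDimLE m (ModuleCat.of R A)) :
    GDimLE m (ModuleCat.of R B) := by
  induction m generalizing A B with
  | zero => exact IsTotallyReflexive.of_equiv e h
  | succ m ih =>
    obtain ⟨F, f, h1, h2, hf, h3⟩ := h
    refine ⟨F, e.toLinearMap ∘ₗ f, h1, h2, e.surjective.comp hf, ?_⟩
    exact ih (LinearEquiv.ofEq _ _ (LinearEquiv.ker_comp e f).symm) h3

lemma exact_subtype_ker (f : A →ₗ[R] B) : Function.Exact (LinearMap.ker f).subtype f :=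
  LinearMap.exact_subtype_ker_map f

lemma exists_free_cover (A : Type u) [AddCommGroup A] [Module R A] [Module.Finite R A] :
    ∃ (n : ℕ) (f : (Fin n → R) →ₗ[R] A), Function.Surjective f :=
  Module.Finite.exists_fin' R A

/-- The horseshoe lemma for `GDimLE`. -/
lemma GDimLE.extension {m : ℕ} {f : A →ₗ[R] B} {g : B →ₗ[R] C} (hf : Function.Injective f)
    (h : Function.Exact f g) (hg : Function.Surjective g) (hA : GDimLE m (ModuleCat.of R A))
    (hC : GDimLE m (ModuleCat.of R C)) : GDimLE m (ModuleCat.of R B) := by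
  induction m generalizing A B C with
  | zero => exact IsTotallyReflexive.extension hf h hg hA hC
  | succ m ih =>
    obtain ⟨FA, a, a1, a2, ha, hA⟩ := hA
    obtain ⟨FC, c, c1, c2, hc, hC⟩ := hC
    obtain ⟨c', hc'⟩ := Module.projective_lifting_property g c hg
    have hcc : ∀ y, g (c' y) = c y := fun y => LinearMap.congr_fun hc' y
    have hgf : ∀ x, g (f x) = 0 := fun x => (h _).2 ⟨x, rfl⟩
    let b : (FA × FC) →ₗ[R] B := (f ∘ₗ a).coprod c'
    have hb : ∀ x y, b (x, y) = f (a x) + c' y := fun x y => by simp [b]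
    have hgb : ∀ z, g (b z) = c z.2 := by
      rintro ⟨x, y⟩
      rw [hb, map_add, hgf, zero_add, hcc]
    have hlift : ∀ z : B, ∀ y : FC, g z = c y → ∃ x, b (x, y) = z := by
      intro z y hzy
      obtain ⟨x, hx⟩ := (h (z - c' y)).1 (by rw [map_sub, hcc, hzy, sub_self])
      obtain ⟨x', rfl⟩ := ha x
      exact ⟨x', by rw [hb, hx, sub_add_cancel]⟩
    refine ⟨ModuleCat.of R (FA × FC), b, inferInstanceAs (Module.Free R (FA × FC)),
      inferInstanceAs (Module.Finite R (FA × FC)), ?_, ?_⟩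
    · intro z
      obtain ⟨y, hy⟩ := hc (g z)
      obtain ⟨x, hx⟩ := hlift z y hy.symm
      exact ⟨_, hx⟩
    · let i : LinearMap.ker a →ₗ[R] LinearMap.ker b :=
        (LinearMap.inl R FA FC ∘ₗ (LinearMap.ker a).subtype).codRestrict _ (by
          rintro ⟨x, hx⟩
          simpa [b] using congrArg f hx)
      let π : LinearMap.ker b →ₗ[R] LinearMap.ker c :=
        (LinearMap.snd R FA FC ∘ₗ (LinearMap.ker b).subtype).codRestrict _ (by
          rintro ⟨z, hz⟩
          have := hgb z
          rw [LinearMap.mem_ker.1 hz, map_zero] at this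
          exact this.symm)
      refine ih (f := i) (g := π) ?_ ?_ ?_ hA hC
      · intro x x' hxx
        have := congrArg (fun z : LinearMap.ker b => (z : FA × FC).1) hxx
        exact Subtype.ext this
      · rintro ⟨⟨x, y⟩, hz⟩
        constructor
        · intro hy
          obtain rfl : y = 0 := congrArg Subtype.val hy
          refine ⟨⟨x, ?_⟩, rfl⟩
          have := LinearMap.mem_ker.1 hz
          rw [hb, map_zero, add_zero] at this
          exact hf (this.trans (map_zero f).symm)
        · rintro ⟨x', hx'⟩
          have := congrArg (fun z : LinearMap.ker b => (z : FA × FC).2) hx'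
          exact Subtype.ext this.symm
      · rintro ⟨y, hy⟩
        obtain ⟨x, hx⟩ := hlift 0 y (by rw [map_zero, LinearMap.mem_ker.1 hy])
        exact ⟨⟨(x, y), hx⟩, rfl⟩

variable [IsNoetherianRing R]

lemma GDimLE.succ {m : ℕ} {X : ModuleCat.{u} R} (h : GDimLE m X) : GDimLE (m + 1) X := by
  induction m generalizing X with
  | zero =>
    have hX := h.finite
    obtain ⟨n, f, hf⟩ := exists_free_cover (R := R) X
    exact ⟨ModuleCat.of R (Fin n → R), f, inferInstanceAs (Module.Free R (Fin n → R)),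
      inferInstanceAs (Module.Finite R (Fin n → R)), hf,
      IsTotallyReflexive.kernel (A := LinearMap.ker f) (B := Fin n → R) (C := X)
        (Submodule.subtype_injective _) (exact_subtype_ker f) hf inferInstance
        isTotallyReflexive_of_projective h⟩
  | succ m ih =>
    obtain ⟨F, f, h1, h2, hf, h3⟩ := h
    exact ⟨F, f, h1, h2, hf, ih h3⟩

lemma GDimLE.mono {m k : ℕ} (hmk : m ≤ k) {X : ModuleCat.{u} R} (h : GDimLE m X) :
    GDimLE k X := by
  induction hmk with
  | refl => exact h
  | step _ ih => exact ih.succ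

/-- A quotient of a totally reflexive module by a submodule of finite Gorenstein dimension has
finite Gorenstein dimension. -/
lemma GDimLE.of_cover {m : ℕ} {g : B →ₗ[R] C} (hB : IsTotallyReflexive (ModuleCat.of R B))
    (hg : Function.Surjective g) (hK : GDimLE m (ModuleCat.of R (LinearMap.ker g))) :
    GDimLE (m + 1) (ModuleCat.of R C) := by
  have := hB.finite
  obtain ⟨n, p, hp⟩ := exists_free_cover (R := R) B
  refine ⟨ModuleCat.of R (Fin n → R), g ∘ₗ p, inferInstanceAs (Module.Free R (Fin n → R)),
    inferInstanceAs (Module.Finite R (Fin n → R)), hg.comp hp, ?_⟩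
  have hker : IsTotallyReflexive (ModuleCat.of R (LinearMap.ker p)) :=
    IsTotallyReflexive.kernel (Submodule.subtype_injective _) (exact_subtype_ker p) hp
      inferInstance isTotallyReflexive_of_projective hB
  let i : LinearMap.ker p →ₗ[R] LinearMap.ker (g ∘ₗ p) :=
    Submodule.inclusion (LinearMap.ker_le_ker_comp p g)
  let π : LinearMap.ker (g ∘ₗ p) →ₗ[R] LinearMap.ker g :=
    (p ∘ₗ (LinearMap.ker (g ∘ₗ p)).subtype).codRestrict _ (fun x => x.2)
  refine GDimLE.extension (f := i) (g := π) (Submodule.inclusion_injective _) ?_ ?_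
    (GDimLE.mono (Nat.zero_le m) hker) hK
  · rintro ⟨x, hx⟩
    constructor
    · intro h0
      exact ⟨⟨x, congrArg Subtype.val h0⟩, rfl⟩
    · rintro ⟨⟨y, hy⟩, hyx⟩
      obtain rfl : y = x := congrArg Subtype.val hyx
      exact Subtype.ext hy
  · rintro ⟨y, hy⟩
    obtain ⟨x, rfl⟩ := hp y
    exact ⟨⟨x, hy⟩, rfl⟩

end GDim

section Conversion

variable {R : Type u} [CommRing R]

/-- The truncation of a totally reflexive resolution of `M` to one of the kernel of its
augmentation. -/
def TotallyReflexiveResolution.tail {M : ModuleCat.{u} R} (P : TotallyReflexiveResolution M) :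
    TotallyReflexiveResolution (ModuleCat.of R (LinearMap.ker P.ε)) where
  G i := P.G (i + 1)
  d i := P.d (i + 1)
  ε := (P.d 0).codRestrict _ (fun x => (P.exact_zero _).2 ⟨x, rfl⟩)
  totallyReflexive i := P.totallyReflexive (i + 1)
  exact_succ i := P.exact_succ (i + 1)
  exact_zero := by
    intro x
    rw [← P.exact_succ 0 x]
    exact Subtype.ext_iff
  surjective := by
    rintro ⟨y, hy⟩
    obtain ⟨x, rfl⟩ := (P.exact_zero y).1 hy
    exact ⟨x, rfl⟩

lemma TotallyReflexiveResolution.gDimLE [IsNoetherianRing R] {m : ℕ} {M : ModuleCat.{u} R}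
    (P : TotallyReflexiveResolution M) (hP : ∀ i, m < i → Subsingleton (P.G i)) :
    GDimLE m M := by
  induction m generalizing M with
  | zero =>
    have := hP 1 one_pos
    refine IsTotallyReflexive.of_equiv (LinearEquiv.ofBijective P.ε ⟨?_, P.surjective⟩)
      (P.totallyReflexive 0)
    rw [← LinearMap.ker_eq_bot, LinearMap.ker_eq_bot']
    intro x hx
    obtain ⟨y, rfl⟩ := (P.exact_zero x).1 hx
    rw [Subsingleton.elim y 0, map_zero]
  | succ m ih =>
    exact GDimLE.of_cover (P.totallyReflexive 0) P.surjective
      (ih P.tail fun i hi => hP (i + 1) (by lia))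

lemma exists_gDimLE_of_gorensteinDimension_lt_top [IsNoetherianRing R] {M : ModuleCat.{u} R}
    (h : gorensteinDimension M < ⊤) : ∃ m, GDimLE m M := by
  obtain ⟨P, hP⟩ := iInf_lt_iff.1 h
  have hle : ∀ i : ℕ, Nontrivial (P.G i) → ((i : ℕ∞) : WithBot ℕ∞) ≤ P.length :=
    fun i hi => le_sSup ⟨i, hi, rfl⟩
  obtain ⟨m, hm⟩ : ∃ m : ℕ, P.length ≤ ((m : ℕ∞) : WithBot ℕ∞) := by
    generalize P.length = l at hP
    induction l with
    | bot => exact ⟨0, bot_le⟩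
    | coe l =>
      have hl : l ≠ ⊤ := by
        rintro rfl
        exact lt_irrefl _ hP
      lift l to ℕ using hl
      exact ⟨l, le_rfl⟩
  refine ⟨m, P.gDimLE fun i hi => ?_⟩
  by_contra hn
  have := (hle i (not_subsingleton_iff_nontrivial.1 hn)).trans hm
  rw [WithBot.coe_le_coe, Nat.cast_le] at this
  lia

lemma GDimLE.exists_resolution {m : ℕ} {M : ModuleCat.{u} R} (h : GDimLE m M) :
    ∃ P : TotallyReflexiveResolution M, ∀ i, m < i → Subsingleton (P.G i) := by
  induction m generalizing M with
  | zero =>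
    refine ⟨{ G := fun i => match i with
                | 0 => M
                | _ + 1 => ModuleCat.of R PUnit
              d := fun _ => 0
              ε := LinearMap.id
              totallyReflexive := fun i => match i with
                | 0 => h
                | _ + 1 => isTotallyReflexive_of_projective
              exact_succ := fun i x => ?_
              exact_zero := fun x => ?_
              surjective := Function.surjective_id }, fun i hi => ?_⟩
    · exact iff_of_true rfl ⟨0, rfl⟩
    · exact ⟨fun hx => ⟨0, hx.symm⟩, fun ⟨_, hx⟩ => hx.symm⟩
    · match i, hi with
      | _ + 1, _ => exact inferInstanceAs (Subsingleton PUnit)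
  | succ m ih =>
    obtain ⟨F, f, h1, h2, hf, h3⟩ := h
    obtain ⟨P, hP⟩ := ih h3
    refine ⟨{ G := fun i => match i with
                | 0 => F
                | i + 1 => P.G i
              d := fun i => match i with
                | 0 => (LinearMap.ker f).subtype ∘ₗ P.ε
                | i + 1 => P.d i
              ε := f
              totallyReflexive := fun i => match i with
                | 0 => isTotallyReflexive_of_projective (A := F)
                | i + 1 => P.totallyReflexive i
              exact_succ := fun i => match i with
                | 0 => fun x => ?_
                | i + 1 => P.exact_succ i
              exact_zero := fun x => ?_
              surjective := hf }, fun i hi => ?_⟩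
    · exact (Submodule.coe_eq_zero (p := LinearMap.ker f)).trans (P.exact_zero x)
    · constructor
      · intro hx
        obtain ⟨y, hy⟩ := P.surjective ⟨x, hx⟩
        exact ⟨y, congrArg Subtype.val hy⟩
      · rintro ⟨y, rfl⟩
        exact (P.ε y).2
    · match i, hi with
      | i + 1, hi => exact hP i (by lia)

lemma GDimLE.gorensteinDimension_le {m : ℕ} {M : ModuleCat.{u} R} (h : GDimLE m M) :
    gorensteinDimension M ≤ ((m : ℕ∞) : WithBot ℕ∞) := by
  obtain ⟨P, hP⟩ := h.exists_resolution
  refine (iInf_le _ P).trans (sSup_le ?_)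
  rintro _ ⟨i, hi, rfl⟩
  rw [WithBot.coe_le_coe, Nat.cast_le]
  by_contra hlt
  exact not_subsingleton_iff_nontrivial.2 hi (hP i (by lia))

end Conversion

/-! ### Total reflexivity relative to a localization -/

section Relative

open TensorProduct RingTheory.Sequence

variable {R : Type u} [CommRing R] {S : Type u} [CommRing S] [Algebra R S]
  (W : Submonoid R) [IsLocalization W S]

variable (S) in
/-- A fraction of `S` inverse to the image of `w`. -/
lemma exists_inv_of_mem {w : R} (hw : w ∈ W) : ∃ u : S, algebraMap R S w * u = 1 :=
  (IsLocalization.map_units S ⟨w, hw⟩).exists_right_inv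

variable {W} in
lemma mem_of_algebraMap_mul_mem (J : Ideal S) {w : R} (hw : w ∈ W) {x : S}
    (h : algebraMap R S w * x ∈ J) : x ∈ J := by
  obtain ⟨u, hu⟩ := exists_inv_of_mem S W hw
  have := J.mul_mem_left u h
  rwa [← mul_assoc, mul_comm u, hu, one_mul] at this

variable {L X A B C F : Type u} [AddCommGroup L] [Module R L] [AddCommGroup X] [Module R X]
  [AddCommGroup A] [Module R A] [AddCommGroup B] [Module R B] [AddCommGroup C] [Module R C]
  [AddCommGroup F] [Module R F]

lemma exists_dual_eq_smul [IsNoetherianRing R] [Module.Finite R L] (g : L →ₗ[R] S) :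
    ∃ (φ : Module.Dual R L) (w : R), w ∈ W ∧
      ∀ x, algebraMap R S (φ x) = algebraMap R S w * g x := by
  have := Module.finitePresentation_of_finite R L
  obtain ⟨φ, w, h⟩ := Module.FinitePresentation.exists_lift_of_isLocalizedModule W
    (Algebra.linearMap R S) g
  refine ⟨φ, w, w.2, fun x => (LinearMap.congr_fun h x).trans ?_⟩
  exact Algebra.smul_def (w : R) (g x)

lemma exists_smul_eq_zero_of_algebraMap [IsNoetherianRing R] [Module.Finite R L]
    (φ : Module.Dual R L) (h : ∀ x, algebraMap R S (φ x) = 0) :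
    ∃ w ∈ W, ∀ x, w * φ x = 0 := by
  obtain ⟨w, h⟩ := Module.Finite.exists_smul_of_comp_eq_of_isLocalizedModule W
    (Algebra.linearMap R S) φ 0 (by ext x; simpa using h x)
  rw [smul_zero] at h
  exact ⟨w, w.2, fun x => LinearMap.congr_fun h x⟩

include W in
variable (S) in
lemma ExtVanish.localization [IsNoetherianRing R] [Module.Finite R X] {n : ℕ}
    (h : ExtVanish R X R (n + 1)) : ExtVanish R X S (n + 1) := by
  induction n generalizing X with
  | zero =>
    obtain ⟨k, p, hp⟩ := exists_free_cover (R := R) X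
    refine extVanish_one_of_extension (Submodule.subtype_injective _) (exact_subtype_ker p) hp
      (extVanish_of_projective 0) fun g => ?_
    obtain ⟨φ, w, hw, hφ⟩ := exists_dual_eq_smul W g
    obtain ⟨ψ, rfl⟩ := h.exists_extension (Submodule.subtype_injective _) (exact_subtype_ker p)
      hp φ
    obtain ⟨u, hu⟩ := exists_inv_of_mem S W hw
    refine ⟨u • (Algebra.linearMap R S ∘ₗ ψ), ?_⟩
    ext x
    change u * algebraMap R S (ψ x) = g x
    have := hφ x
    simp only [LinearMap.comp_apply, Submodule.subtype_apply] at this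
    rw [this, ← mul_assoc, mul_comm u, hu, one_mul]
  | succ n ih =>
    obtain ⟨k, p, hp⟩ := exists_free_cover (R := R) X
    rw [← extVanish_shift_iff (Submodule.subtype_injective _) (exact_subtype_ker p) hp] at h ⊢
    exact ih h

/-- If `Ext^{n+1}(X, S) = 0` for a localization `S` of `R`, then every element of
`Ext^{n+1}(X, R)` is killed by some element of the multiplicative set. -/
lemma exists_smul_ext_eq_zero [IsNoetherianRing R] [Module.Finite R X] {n : ℕ}
    (h : ExtVanish R X S (n + 1))
    (e : Ext.{u} (ModuleCat.of R X) (ModuleCat.of R R) (n + 1)) : ∃ w ∈ W, w • e = 0 := by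
  induction n generalizing X with
  | zero =>
    obtain ⟨k, p, hp⟩ := exists_free_cover (R := R) X
    obtain ⟨δ, hδ, hδ'⟩ := exists_exact_ext_one (Y := R) (Submodule.subtype_injective _)
      (exact_subtype_ker p) hp
    obtain ⟨g, rfl⟩ := hδ e
    obtain ⟨ψ, hψ⟩ := h.exists_extension (Submodule.subtype_injective _) (exact_subtype_ker p)
      hp (Algebra.linearMap R S ∘ₗ g)
    obtain ⟨φ, w, hw, hφ⟩ := exists_dual_eq_smul W ψ
    obtain ⟨v, hv, hv'⟩ := exists_smul_eq_zero_of_algebraMap (S := S) W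
      (w • g - φ ∘ₗ (LinearMap.ker p).subtype) (fun x => by
        have h1 := LinearMap.congr_fun hψ x
        simp only [LinearMap.comp_apply, Algebra.linearMap_apply] at h1
        simp only [LinearMap.sub_apply, LinearMap.smul_apply, LinearMap.comp_apply, map_sub,
          hφ, smul_eq_mul, map_mul, h1, sub_self])
    refine ⟨v * w, W.mul_mem hv hw, ?_⟩
    rw [← map_smul, hδ']
    refine ⟨v • φ, ?_⟩
    ext x
    have := hv' x
    simp only [LinearMap.sub_apply, LinearMap.smul_apply, LinearMap.comp_apply, smul_eq_mul,
      mul_sub, sub_eq_zero] at this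
    simp only [LinearMap.smul_apply, LinearMap.comp_apply, smul_eq_mul, mul_assoc, this]
  | succ n ih =>
    obtain ⟨k, p, hp⟩ := exists_free_cover (R := R) X
    rw [← extVanish_shift_iff (Submodule.subtype_injective _) (exact_subtype_ker p) hp] at h
    let E := extShift (Y := R) (Submodule.subtype_injective _) (exact_subtype_ker p) hp n
    obtain ⟨w, hw, hw'⟩ := ih h (E.symm e)
    refine ⟨w, hw, ?_⟩
    rw [← map_smul] at hw'
    exact E.symm.map_eq_zero_iff.1 hw'

variable (S) in
/-- Total reflexivity of `L` after localization to `S`, expressed over `R`: the groups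
`Ext^n(L, S)` and `Ext^n(L^*, S)` vanish for `n > 0`, and `L` becomes isomorphic to
`Hom(L^*, S)` after localization. -/
structure IsRelTotallyReflexive (L : Type u) [AddCommGroup L] [Module R L] : Prop where
  finite : Module.Finite R L
  ext_eq_zero : ∀ n, ExtVanish R L S (n + 1)
  ext_dual_eq_zero : ∀ n, ExtVanish R (Module.Dual R L) S (n + 1)
  surj : ∀ φ : Module.Dual R L →ₗ[R] S, ∃ (x : L) (w : R), w ∈ W ∧
    ∀ f, algebraMap R S w * φ f = algebraMap R S (f x)
  inj : ∀ x : L, (∀ f : Module.Dual R L, algebraMap R S (f x) = 0) → ∃ w ∈ W, w • x = 0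

instance finite_dual [IsNoetherianRing R] [Module.Finite R L] :
    Module.Finite R (Module.Dual R L) := by
  obtain ⟨k, p, hp⟩ := exists_free_cover (R := R) L
  exact Module.Finite.of_injective p.dualMap (LinearMap.dualMap_injective_of_surjective hp)

variable (S) in
lemma IsTotallyReflexive.relative [IsNoetherianRing R]
    (h : IsTotallyReflexive (ModuleCat.of R L)) : IsRelTotallyReflexive S W L := by
  obtain ⟨h1, h2, h3, h4⟩ := isTotallyReflexive_iff.1 h
  refine ⟨h1, fun n => (h3 n).localization S W, fun n => (h4 n).localization S W,
    fun φ => ?_, fun x hx => ?_⟩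
  · obtain ⟨φ₀, w, hw, hφ⟩ := exists_dual_eq_smul W φ
    obtain ⟨x, rfl⟩ := h2.2 φ₀
    exact ⟨x, w, hw, fun f => (hφ f).symm⟩
  · obtain ⟨w, hw, hw'⟩ := exists_smul_eq_zero_of_algebraMap W (Module.Dual.eval R L x) hx
    refine ⟨w, hw, h2.1 ?_⟩
    rw [map_zero]
    ext f
    simpa using hw' f

variable {W}

/-- A module whose elements are killed by a common element of `W` has no `Ext` to `S`. -/
lemma extVanish_of_smul_eq_zero {w : R} (hw : w ∈ W) (hX : ∀ x : X, w • x = 0) (n : ℕ) :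
    ExtVanish R X S n := by
  refine extVanish_of_smul_eq_zero_of_bijective hX ?_ n
  obtain ⟨u, hu⟩ := exists_inv_of_mem S W hw
  refine ⟨fun a b hab => ?_, fun b => ⟨u * b, ?_⟩⟩
  · simp only [Algebra.smul_def] at hab
    linear_combination u * hab - (a - b) * hu
  · simp only [Algebra.smul_def]
    rw [← mul_assoc, hu, one_mul]

/-- Relative total reflexivity passes to a quotient `C` with vanishing `Ext^n(C, S)`. The cokernel
of `B^* → A^*` is `Ext^1(C, R)`, which vanishes after localization. -/
lemma IsRelTotallyReflexive.quotient [IsNoetherianRing R] {f : A →ₗ[R] B} {g : B →ₗ[R] C}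
    (hf : Function.Injective f) (h : Function.Exact f g) (hg : Function.Surjective g)
    [Module.Projective R B]
    (hA : IsRelTotallyReflexive S W A) (hB : IsRelTotallyReflexive S W B)
    (hC : ∀ n, ExtVanish R C S (n + 1)) : IsRelTotallyReflexive S W C := by
  have := hA.finite
  have := hB.finite
  have hCf : Module.Finite R C := Module.Finite.of_surjective g hg
  let I : Submodule R (Module.Dual R A) := LinearMap.range f.dualMap
  -- `A^*/I` is killed by an element of `W`: up to denominators, functionals on `A` extend to `B`,
  -- because `Ext^1(C, S) = 0`.
  have hE : ∃ w ∈ W, ∀ x : Module.Dual R A ⧸ I, w • x = 0 := by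
    have key : ∀ φ : Module.Dual R A, ∃ w ∈ W, w • φ ∈ I := by
      intro φ
      obtain ⟨ψ, hψ⟩ := (hC 0).exists_extension hf h hg (Algebra.linearMap R S ∘ₗ φ)
      obtain ⟨ψ₀, w, hw, hw'⟩ := exists_dual_eq_smul W ψ
      obtain ⟨v, hv, hv'⟩ := exists_smul_eq_zero_of_algebraMap (S := S) W
        (w • φ - ψ₀ ∘ₗ f) (fun x => by
          have h1 := LinearMap.congr_fun hψ x
          simp only [LinearMap.comp_apply, Algebra.linearMap_apply] at h1
          simp only [LinearMap.sub_apply, LinearMap.smul_apply, LinearMap.comp_apply, map_sub,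
            hw', smul_eq_mul, map_mul, h1, sub_self])
      refine ⟨v * w, W.mul_mem hv hw, v • ψ₀, ?_⟩
      ext x
      have := hv' x
      simp only [LinearMap.sub_apply, LinearMap.smul_apply, LinearMap.comp_apply, smul_eq_mul,
        mul_sub, sub_eq_zero] at this
      simp only [LinearMap.dualMap_apply, LinearMap.smul_apply, smul_eq_mul, mul_assoc, this]
    have hsub : Subsingleton (LocalizedModule W (Module.Dual R A ⧸ I)) := by
      rw [LocalizedModule.subsingleton_iff]
      intro x
      obtain ⟨φ, rfl⟩ := I.mkQ_surjective x
      obtain ⟨w, hw, hw'⟩ := key φ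
      exact ⟨w, hw, by rw [← map_smul]; exact (Submodule.Quotient.mk_eq_zero I).2 hw'⟩
    obtain ⟨w, hw⟩ := Module.Finite.exists_smul_of_comp_eq_of_isLocalizedModule W
      (LocalizedModule.mkLinearMap W (Module.Dual R A ⧸ I)) LinearMap.id 0
      (by ext x; exact Subsingleton.elim _ _)
    rw [smul_zero] at hw
    exact ⟨w, w.2, fun x => LinearMap.congr_fun hw x⟩
  obtain ⟨w, hw, hE⟩ := hE
  have hEv : ∀ n, ExtVanish R (Module.Dual R A ⧸ I) S n := fun n =>
    extVanish_of_smul_eq_zero hw hE n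
  have hex : Function.Exact I.subtype I.mkQ := LinearMap.exact_subtype_mkQ I
  have hI : ∀ n, ExtVanish R I S (n + 1) := fun n =>
    (hA.ext_dual_eq_zero n).sub_left I.injective_subtype hex I.mkQ_surjective (hEv _)
  have gi := LinearMap.dualMap_injective_of_surjective hg
  have hfI : Function.Surjective f.dualMap.rangeRestrict := f.dualMap.surjective_rangeRestrict
  have hex2 : Function.Exact g.dualMap f.dualMap.rangeRestrict := by
    intro φ
    rw [← exact_dualMap h hg φ]
    exact Subtype.ext_iff
  refine ⟨hCf, hC, fun n => ?_, fun φ => ?_, fun c hc => ?_⟩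
  · exact (hB.ext_dual_eq_zero n).sub_left gi hex2 hfI (hI _)
  · obtain ⟨ψ, hψ⟩ := (hI 0).exists_extension gi hex2 hfI φ
    obtain ⟨b, v, hv, hv'⟩ := hB.surj ψ
    refine ⟨g b, v, hv, fun k => ?_⟩
    rw [← hψ]
    exact hv' (g.dualMap k)
  · obtain ⟨b, rfl⟩ := hg c
    -- Evaluation at `b` factors through the image of `B^*` in `A^*` and extends to `A^*`.
    have hlc := LinearMap.exact_lcomp_of_exact_of_surjective (M1 := Module.Dual R C)
      (M2 := Module.Dual R B) (M3 := I) (f := g.dualMap)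
      (g := f.dualMap.rangeRestrict) S hex2 hfI
    obtain ⟨θ, hθ⟩ := (hlc (Algebra.linearMap R S ∘ₗ Module.Dual.eval R B b)).1
      (LinearMap.ext fun k => hc k)
    rw [LinearMap.lcomp_apply'] at hθ
    obtain ⟨ψ, hψ⟩ := ExtVanish.exists_extension (A := I) I.injective_subtype hex
      I.mkQ_surjective (hEv 1) θ
    obtain ⟨a, v, hv, hv'⟩ := hA.surj ψ
    obtain ⟨v', hv₁, hv₂⟩ := hB.inj (v • b - f a) (fun k => by
      have h1 := hv' (f.dualMap k)
      have h2 : ψ (f.dualMap k) = algebraMap R S (k b) := by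
        exact (LinearMap.congr_fun hψ (f.dualMap.rangeRestrict k)).trans
          (LinearMap.congr_fun hθ k)
      rw [h2, ← map_mul] at h1
      rw [map_sub, map_smul, smul_eq_mul, map_sub, h1]
      exact sub_self _)
    refine ⟨v' * v, W.mul_mem hv₁ hv, ?_⟩
    have := congrArg g hv₂
    rw [map_smul, map_sub, (h _).2 ⟨a, rfl⟩, sub_zero, map_smul, map_zero, smul_smul] at this
    exact this

/-- A module of finite Gorenstein dimension whose `Ext` into `S` vanishes in positive degrees is
totally reflexive relative to `S`. -/
lemma GDimLE.isRelTotallyReflexive [IsNoetherianRing R] {m : ℕ} {X : ModuleCat.{u} R}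
    (h : GDimLE m X) (hX : ∀ n, ExtVanish R X S (n + 1)) : IsRelTotallyReflexive S W X := by
  induction m generalizing X with
  | zero => exact IsTotallyReflexive.relative S W h
  | succ m ih =>
    obtain ⟨F, f, h1, h2, hf, h3⟩ := h
    refine IsRelTotallyReflexive.quotient (Submodule.subtype_injective _) (exact_subtype_ker f) hf
      (ih h3 fun n => ?_) (IsTotallyReflexive.relative S W isTotallyReflexive_of_projective) hX
    exact (extVanish_of_projective n).sub_left (Submodule.subtype_injective _)
      (exact_subtype_ker f) hf (hX (n + 1))

end Relative

/-! ### The Auslander–Bridger inequality -/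

section AuslanderBridger

open TensorProduct RingTheory.Sequence Pointwise

variable {S : Type u} [CommRing S]

/-- Going to a kernel of a surjection from a module on which `rs` is regular improves
regularity by one step. -/
lemma isWeaklyRegular_take_succ {A B C : Type u} [AddCommGroup A] [Module S A] [AddCommGroup B]
    [Module S B] [AddCommGroup C] [Module S C] {f : A →ₗ[S] B} {g : B →ₗ[S] C}
    (hf : Function.Injective f) (h : Function.Exact f g) (hg : Function.Surjective g)
    {rs : List S} {a : ℕ} (hB : IsWeaklyRegular B rs) (hC : IsWeaklyRegular C (rs.take a)) :
    IsWeaklyRegular A (rs.take (a + 1)) := by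
  induction rs generalizing A B C a with
  | nil => simp
  | cons r rs ih =>
    rw [isWeaklyRegular_cons_iff] at hB
    rw [List.take_succ_cons, isWeaklyRegular_cons_iff]
    refine ⟨hB.1.of_injective f hf, ?_⟩
    cases a with
    | zero => simp
    | succ a =>
      rw [List.take_succ_cons, isWeaklyRegular_cons_iff] at hC
      refine ih (f := QuotSMulTop.map r f) (g := QuotSMulTop.map r g) ?_
        (QuotSMulTop.map_exact r h hg) (QuotSMulTop.map_surjective r hg) hB.2 hC.2
      have h0 : Function.Exact (0 : PUnit.{u + 1} →ₗ[S] A) f :=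
        LinearMap.exact_zero_iff_injective _ f |>.2 hf
      have := QuotSMulTop.map_first_exact_on_four_term_exact_of_isSMulRegular_last h0 h hC.1
      rw [map_zero] at this
      exact LinearMap.exact_zero_iff_injective _ _ |>.1 this

variable {R : Type u} [CommRing R] [Algebra R S]

/-- Multiplication by `r` on an `S`-module, as an `R`-linear map. -/
def smulHom (R : Type u) [CommRing R] [Algebra R S] (Y : Type u) [AddCommGroup Y] [Module R Y]
    [Module S Y] [IsScalarTower R S Y] (r : S) : Y →ₗ[R] Y :=
  (LinearMap.lsmul S Y r).restrictScalars R

/-- The projection `Y → Y/rY` of an `S`-module, as an `R`-linear map. -/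
def quotHom (R : Type u) [CommRing R] [Algebra R S] (Y : Type u) [AddCommGroup Y] [Module R Y]
    [Module S Y] [IsScalarTower R S Y] (r : S) : Y →ₗ[R] QuotSMulTop r Y :=
  (Submodule.mkQ (r • (⊤ : Submodule S Y))).restrictScalars R

section

variable {Y : Type u} [AddCommGroup Y] [Module R Y] [Module S Y] [IsScalarTower R S Y] (r : S)

lemma exact_smulHom_quotHom : Function.Exact (smulHom R Y r) (quotHom R Y r) :=
  LinearMap.exact_lsmul_mkQ_smul_top Y r

lemma quotHom_surjective : Function.Surjective (quotHom R Y r) :=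
  fun x => Submodule.mkQ_surjective (r • (⊤ : Submodule S Y)) x

end

/-- Maps into `Y/(rs)Y` lift to `Y` if `rs` is regular on `Y` and
`Ext^n(D, Y) = 0` for `n > 0`. -/
lemma exists_lift_quotient_ofList {D Y : Type u} [AddCommGroup D] [Module R D] [AddCommGroup Y]
    [Module R Y] [Module S Y] [IsScalarTower R S Y] {rs : List S} (hrs : IsWeaklyRegular Y rs)
    (hD : ∀ n, ExtVanish R D Y (n + 1))
    (φ : D →ₗ[R] Y ⧸ (Ideal.ofList rs • ⊤ : Submodule S Y)) :
    ∃ ψ : D →ₗ[R] Y, ∀ d, Submodule.Quotient.mk (ψ d) = φ d := by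
  induction rs generalizing Y with
  | nil =>
    have h0 : (Ideal.ofList ([] : List S) • ⊤ : Submodule S Y) = ⊥ := by simp
    let e := (Submodule.quotEquivOfEqBot _ h0).restrictScalars R
    refine ⟨e.toLinearMap ∘ₗ φ, fun d => ?_⟩
    apply e.injective
    exact Submodule.quotEquivOfEqBot_apply_mk _ h0 _
  | cons r rs ih =>
    rw [isWeaklyRegular_cons_iff] at hrs
    have hinj : Function.Injective (smulHom R Y r) := hrs.1
    have hex := exact_smulHom_quotHom (R := R) (Y := Y) r
    have hsurj := quotHom_surjective (R := R) (Y := Y) r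
    have hq : ∀ n, ExtVanish R D (QuotSMulTop r Y) (n + 1) := fun n =>
      ExtVanish.quot_right hinj hex hsurj (hD n) (hD (n + 1))
    let e := (Submodule.quotOfListConsSMulTopEquivQuotSMulTopInner Y r rs).restrictScalars R
    obtain ⟨ψ₁, hψ₁⟩ := ih (Y := QuotSMulTop r Y) hrs.2 hq (e.toLinearMap ∘ₗ φ)
    obtain ⟨ψ, hψ⟩ := ExtVanish.exists_lift hinj hex hsurj (hD 0) ψ₁
    refine ⟨ψ, fun d => e.injective ?_⟩
    refine Eq.trans ?_ (hψ₁ d)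
    rw [← hψ]
    rfl

/-- If all functionals on a finite free module `F` take values in an ideal `J` of `S` at `x`, then
`1 ⊗ x` lies in `J (S ⊗ F)`. -/
lemma one_tmul_mem_of_forall_dual {F : Type u} [AddCommGroup F] [Module R F] [Module.Free R F]
    [Module.Finite R F] (J : Ideal S) (x : F)
    (hx : ∀ f : Module.Dual R F, algebraMap R S (f x) ∈ J) :
    (1 : S) ⊗ₜ[R] x ∈ (J • ⊤ : Submodule S (S ⊗[R] F)) := by
  let b := Module.Free.chooseBasis R F
  rw [← b.sum_repr x, TensorProduct.tmul_sum]
  refine Submodule.sum_mem _ fun i _ => ?_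
  rw [TensorProduct.tmul_smul, ← algebraMap_smul S (b.repr x i) ((1 : S) ⊗ₜ[R] b i)]
  exact Submodule.smul_mem_smul (hx (b.coord i)) Submodule.mem_top

lemma isWeaklyRegular_tensor_free {F : Type u} [AddCommGroup F] [Module R F] [Module.Free R F]
    {rs : List S} (h : IsWeaklyRegular S rs) : IsWeaklyRegular (S ⊗[R] F) rs :=
  ((TensorProduct.rid S (S ⊗[R] F)).isWeaklyRegular_congr rs).1 h.isWeaklyRegular_lTensor

variable (R) in
lemma baseChange_injective_quotient {A B C : Type u} [AddCommGroup A] [Module R A]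
    [AddCommGroup B] [Module R B] [AddCommGroup C] [Module R C] [Module.Flat R S]
    {f : A →ₗ[R] B} {g : B →ₗ[R] C}
    (hf : Function.Injective f) (h : Function.Exact f g) (hg : Function.Surjective g)
    {rs : List S} (hC : IsWeaklyRegular (S ⊗[R] C) rs) {x : S ⊗[R] A}
    (hx : f.baseChange S x ∈ (Ideal.ofList rs • ⊤ : Submodule S (S ⊗[R] B))) :
    x ∈ (Ideal.ofList rs • ⊤ : Submodule S (S ⊗[R] A)) := by
  have hf' : Function.Injective (f.baseChange S) :=
    Module.Flat.lTensor_preserves_injective_linearMap f hf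
  have h' : Function.Exact (f.baseChange S) (g.baseChange S) := lTensor_exact S h hg
  have hg' : Function.Surjective (g.baseChange S) := LinearMap.lTensor_surjective S hg
  have h0 : Function.Exact (0 : PUnit.{u + 1} →ₗ[S] S ⊗[R] A) (f.baseChange S) :=
    LinearMap.exact_zero_iff_injective _ _ |>.2 hf'
  have := map_first_exact_on_four_term_right_exact_of_isSMulRegular_last h0 h' hg' hC
  obtain ⟨y, hy⟩ := (this (Submodule.Quotient.mk x)).1
    ((Submodule.Quotient.mk_eq_zero _).2 hx)
  obtain ⟨y, rfl⟩ := Submodule.Quotient.mk_surjective _ y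
  rw [← Submodule.Quotient.mk_eq_zero, ← hy]
  exact Submodule.Quotient.mk_zero _

variable {W : Submonoid R} [IsLocalization W S]

/-- `rs` is a regular sequence on the local ring `S` that no element of the maximal ideal extends.
That `S/(rs)` is nonzero need not be required, since otherwise `0` would extend `rs`. -/
structure IsMaximalRegular (S : Type u) [CommRing S] [IsLocalRing S] (rs : List S) : Prop where
  regular : IsWeaklyRegular S rs
  maximal : ∀ x ∈ IsLocalRing.maximalIdeal S,
    ¬ IsSMulRegular (S ⧸ (Ideal.ofList rs • ⊤ : Submodule S S)) x

variable [IsNoetherianRing R] [IsLocalRing S]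

/-- The critical step of the Auslander–Bridger inequality. The cokernel `E` of `F^* → L^*` has
no nonzero map to `S/(rs)`, since such a map comes from an element of `L` lying in `(rs)F`, hence
in `(rs)L`. As `rs` is maximal, `E` vanishes after localization. -/
lemma extVanish_one_of_isMaximalRegular {F X : Type u} [AddCommGroup F] [Module R F]
    [AddCommGroup X] [Module R X] [Module.Free R F] [Module.Finite R F] {p : F →ₗ[R] X}
    (hp : Function.Surjective p) (hL : IsRelTotallyReflexive S W (LinearMap.ker p))
    {rs : List S} (hrs : IsMaximalRegular S rs) (hX : IsWeaklyRegular (S ⊗[R] X) rs) :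
    ExtVanish R X S 1 := by
  have := IsLocalization.flat S W
  have : IsNoetherianRing S := IsLocalization.isNoetherianRing W S inferInstance
  have := hL.finite
  let L := LinearMap.ker p
  let I : Submodule R (Module.Dual R L) := LinearMap.range L.subtype.dualMap
  let E := Module.Dual R L ⧸ I
  let J : Submodule S S := Ideal.ofList rs • ⊤
  have hJ : J = Ideal.ofList rs := by simp [J]
  have hzero : ∀ Φ : S ⊗[R] E →ₗ[S] S ⧸ J, Φ = 0 := by
    intro Φ
    let φ : Module.Dual R L →ₗ[R] S ⧸ J :=
      (Φ.restrictScalars R) ∘ₗ (TensorProduct.mk R S E 1) ∘ₗ I.mkQ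
    suffices hφ : φ = 0 by
      apply TensorProduct.AlgebraTensorModule.ext
      intro s e
      obtain ⟨f, rfl⟩ := I.mkQ_surjective e
      have h1 : s ⊗ₜ[R] I.mkQ f = s • ((1 : S) ⊗ₜ[R] I.mkQ f) := by
        rw [TensorProduct.smul_tmul', smul_eq_mul, mul_one]
      rw [h1, map_smul, LinearMap.zero_apply]
      have h2 : Φ ((1 : S) ⊗ₜ[R] I.mkQ f) = 0 := LinearMap.congr_fun hφ f
      rw [h2, smul_zero]
    obtain ⟨ψ, hψ⟩ := exists_lift_quotient_ofList hrs.regular hL.ext_dual_eq_zero φ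
    obtain ⟨x, w, hw, hx⟩ := hL.surj ψ
    have hx1 : ∀ k : Module.Dual R F, algebraMap R S (k x) ∈ J := by
      intro k
      have h1 : φ (L.subtype.dualMap k) = 0 := by
        have : I.mkQ (L.subtype.dualMap k) = 0 := (Submodule.Quotient.mk_eq_zero I).2 ⟨k, rfl⟩
        simp only [φ, LinearMap.comp_apply, this, map_zero]
      rw [← hψ, Submodule.Quotient.mk_eq_zero] at h1
      have h2 := hx (L.subtype.dualMap k)
      have h3 : (L.subtype.dualMap k) x = k x := rfl
      rw [← h3, ← h2]
      exact J.smul_mem _ h1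
    have hx2 := one_tmul_mem_of_forall_dual J (x : F) hx1
    have hx3 : (1 : S) ⊗ₜ[R] x ∈ (Ideal.ofList rs • ⊤ : Submodule S (S ⊗[R] L)) := by
      refine baseChange_injective_quotient R L.injective_subtype (exact_subtype_ker p) hp hX ?_
      rw [LinearMap.baseChange_tmul, ← hJ]
      exact hx2
    ext f
    rw [← hψ, LinearMap.zero_apply, Submodule.Quotient.mk_eq_zero]
    refine mem_of_algebraMap_mul_mem J hw ?_
    rw [hx]
    let Λ : S ⊗[R] L →ₗ[S] S := (TensorProduct.AlgebraTensorModule.rid R S S).toLinearMap ∘ₗ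
      LinearMap.baseChange S f
    have h1 : Λ ((1 : S) ⊗ₜ[R] x) = algebraMap R S (f x) := by
      simp [Λ, Algebra.algebraMap_eq_smul_one]
    rw [← h1]
    have h2 : (Ideal.ofList rs • ⊤ : Submodule S (S ⊗[R] L)) ≤ J.comap Λ := by
      rw [← Submodule.map_le_iff_le_comap, Submodule.map_smul'']
      exact Submodule.smul_mono le_rfl le_top
    exact h2 hx3
  have hsub : Subsingleton (S ⊗[R] E →ₗ[S] S ⧸ J) := ⟨fun a b => (hzero a).trans (hzero b).symm⟩
  obtain ⟨r, hr, hreg⟩ := IsSMulRegular.subsingleton_linearMap_iff.1 hsub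
  have hu : IsUnit r := by
    by_contra hn
    exact hrs.maximal r ((IsLocalRing.mem_maximalIdeal r).2 hn) hreg
  have hE0 : ∀ e : S ⊗[R] E, e = 0 := by
    intro e
    have := Module.mem_annihilator.1 hr e
    exact hu.smul_eq_zero.1 this
  obtain ⟨w, hw⟩ := Module.Finite.exists_smul_of_comp_eq_of_isLocalizedModule W
    (TensorProduct.mk R S E 1) LinearMap.id 0 (by ext x; exact (hE0 _).trans (hE0 _).symm)
  rw [smul_zero] at hw
  refine extVanish_one_of_extension L.injective_subtype (exact_subtype_ker p) hp
    (extVanish_of_projective 0) fun g => ?_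
  obtain ⟨φ, v, hv, hφ⟩ := exists_dual_eq_smul W g
  have h1 : I.mkQ ((w : R) • φ) = 0 := LinearMap.congr_fun hw (I.mkQ φ)
  obtain ⟨k, hk⟩ := (Submodule.Quotient.mk_eq_zero I).1 h1
  obtain ⟨c, hc⟩ := exists_inv_of_mem S W (W.mul_mem w.2 hv)
  refine ⟨c • (Algebra.linearMap R S ∘ₗ k), ?_⟩
  ext x
  have h2 : k x = w * φ x := LinearMap.congr_fun hk x
  change c * algebraMap R S (k x) = g x
  rw [h2, map_mul, hφ]
  rw [map_mul] at hc
  linear_combination g x * hc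

/-- The Auslander–Bridger inequality over `S`, for the modules whose base change to `S` already
has an initial segment of `rs` as a regular sequence. Each syzygy lengthens this segment by one, and
once it is all of `rs`, even `Ext^1(X, S)` vanishes. -/
lemma GDimLE.extVanish_of_isWeaklyRegular {m : ℕ} {X : Type u} [AddCommGroup X] [Module R X]
    (h : GDimLE m (ModuleCat.of R X)) {rs : List S} (hrs : IsMaximalRegular S rs) {a : ℕ}
    (hX : IsWeaklyRegular (S ⊗[R] X) (rs.take a)) {j : ℕ} (hj : rs.length < j + 1 + a)
    (W : Submonoid R) [IsLocalization W S] :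
    ExtVanish R X S (j + 1) := by
  induction m generalizing X a j with
  | zero => exact (IsTotallyReflexive.relative S W h).ext_eq_zero j
  | succ m ih =>
    have := IsLocalization.flat S W
    obtain ⟨F, p, h1, h2, hp, h3⟩ := h
    have hK : IsWeaklyRegular (S ⊗[R] LinearMap.ker p) (rs.take (a + 1)) :=
      isWeaklyRegular_take_succ (f := (LinearMap.ker p).subtype.baseChange S)
        (g := p.baseChange S)
        (Module.Flat.lTensor_preserves_injective_linearMap _ (Submodule.subtype_injective _))
        (lTensor_exact S (exact_subtype_ker p) hp) (LinearMap.lTensor_surjective S hp)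
        (isWeaklyRegular_tensor_free hrs.regular) hX
    cases j with
    | succ j =>
      rw [← extVanish_shift_iff (Submodule.subtype_injective _) (exact_subtype_ker p) hp]
      exact ih h3 hK (by lia)
    | zero =>
      rw [List.take_of_length_le (by lia)] at hX
      exact extVanish_one_of_isMaximalRegular hp
        (h3.isRelTotallyReflexive (W := W) fun n => ih h3 hK (by lia)) hrs hX

/-- The Auslander–Bridger inequality: if `X` has finite Gorenstein dimension, then `Ext^j(X, S)`
vanishes for `j` greater than the length of a maximal regular sequence of `S`. -/
lemma GDimLE.extVanish_of_length_lt {m : ℕ} {X : Type u} [AddCommGroup X] [Module R X]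
    (h : GDimLE m (ModuleCat.of R X)) {rs : List S} (hrs : IsMaximalRegular S rs) {j : ℕ}
    (hj : rs.length < j + 1) (W : Submonoid R) [IsLocalization W S] :
    ExtVanish R X S (j + 1) :=
  h.extVanish_of_isWeaklyRegular hrs (a := 0) (by simp) (by simpa using hj) W

end AuslanderBridger

/-! ### Depth, regular sequences and `Ext` -/

section DepthExt

open TensorProduct RingTheory.Sequence Pointwise

lemma exists_isRegular_of_lt_depth {S M : Type u} [CommRing S] [IsLocalRing S] [AddCommGroup M]
    [Module S M] {l : ℕ} (h : (l : ℕ∞) < depth S M) :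
    Subsingleton M ∨ ∃ rs : List S, (∀ r ∈ rs, r ∈ IsLocalRing.maximalIdeal S) ∧
      IsRegular M rs ∧ l < rs.length := by
  by_cases hM : Subsingleton M
  · exact Or.inl hM
  · rw [depth, if_neg hM] at h
    obtain ⟨rs, h⟩ := lt_iSup_iff.1 h
    obtain ⟨⟨h1, h2⟩, h⟩ := lt_iSup_iff.1 h
    exact Or.inr ⟨rs, h1, h2, by exact_mod_cast h⟩

lemma length_le_depth {S : Type u} [CommRing S] [IsLocalRing S] {rs : List S}
    (h1 : ∀ r ∈ rs, r ∈ IsLocalRing.maximalIdeal S) (h2 : IsRegular S rs) :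
    (rs.length : ℕ∞) ≤ depth S S := by
  rw [depth, if_neg (not_subsingleton S)]
  exact le_iSup₂_of_le (f := fun (rs : List S) _ => (rs.length : ℕ∞)) rs ⟨h1, h2⟩ le_rfl

lemma depth_ne_top (S : Type u) [CommRing S] [IsLocalRing S] [IsNoetherianRing S] :
    depth S S ≠ ⊤ := by
  obtain ⟨d, hd⟩ : ∃ d : ℕ, ringKrullDim S ≤ d := by
    have h := ringKrullDim_lt_top (R := S)
    generalize ringKrullDim S = D at h
    induction D with
    | bot => exact ⟨0, bot_le⟩
    | coe D =>
      have hD : D ≠ ⊤ := by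
        rintro rfl
        exact lt_irrefl _ h
      lift D to ℕ using hD
      exact ⟨D, le_rfl⟩
  refine ne_top_of_le_ne_top (ENat.natCast_ne_top d) ?_
  rw [depth, if_neg (not_subsingleton S)]
  refine iSup₂_le fun rs hrs => ?_
  have h1 := ringKrullDim_add_length_eq_ringKrullDim_of_isRegular rs hrs.2
  have : Nontrivial (S ⧸ Ideal.ofList rs) := by
    have := hrs.2.quot_ofList_smul_nontrivial ⊤
    simpa using this
  have h2 : (0 : WithBot ℕ∞) ≤ ringKrullDim (S ⧸ Ideal.ofList rs) :=
    ringKrullDim_nonneg_of_nontrivial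
  have h3 : ((rs.length : ℕ∞) : WithBot ℕ∞) ≤ ((d : ℕ∞) : WithBot ℕ∞) := by
    calc ((rs.length : ℕ∞) : WithBot ℕ∞) = 0 + (rs.length : WithBot ℕ∞) := by simp
      _ ≤ ringKrullDim (S ⧸ Ideal.ofList rs) + rs.length := by gcongr
      _ = ringKrullDim S := h1
      _ ≤ d := hd
  exact WithBot.coe_le_coe.1 h3

/-- In a Noetherian local ring some maximal regular sequence has length at most the depth. -/
lemma exists_isMaximalRegular (S : Type u) [CommRing S] [IsLocalRing S] [IsNoetherianRing S] :
    ∃ rs : List S, IsMaximalRegular S rs ∧ (rs.length : ℕ∞) ≤ depth S S := by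
  by_contra! H
  have key : ∀ k : ℕ, ∃ rs : List S, (∀ r ∈ rs, r ∈ IsLocalRing.maximalIdeal S) ∧
      IsRegular S rs ∧ rs.length = k := by
    intro k
    induction k with
    | zero => exact ⟨[], by simp, IsRegular.nil S S, rfl⟩
    | succ k ih =>
      obtain ⟨rs, h1, h2, rfl⟩ := ih
      obtain ⟨x, hx, hreg⟩ : ∃ x ∈ IsLocalRing.maximalIdeal S,
          IsSMulRegular (S ⧸ (Ideal.ofList rs • ⊤ : Submodule S S)) x := by
        by_contra! hn
        exact (H rs ⟨h2.toIsWeaklyRegular, hn⟩).not_ge (length_le_depth h1 h2)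
      have hmem : ∀ r ∈ rs ++ [x], r ∈ IsLocalRing.maximalIdeal S := by
        intro r hr
        rcases List.mem_append.1 hr with hr | hr
        · exact h1 r hr
        · rwa [List.mem_singleton.1 hr]
      refine ⟨rs ++ [x], hmem, ?_, by simp⟩
      refine IsRegular.of_isWeaklyRegular_of_mem_maximalIdeal S hmem ?_
      rw [isWeaklyRegular_append_iff, isWeaklyRegular_singleton_iff]
      exact ⟨h2.toIsWeaklyRegular, hreg⟩
  obtain ⟨d, hd⟩ := ENat.ne_top_iff_exists.1 (depth_ne_top S)
  obtain ⟨rs, h1, h2, h3⟩ := key (d + 1)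
  have := length_le_depth h1 h2
  rw [← hd, h3, Nat.cast_le] at this
  lia

variable {R : Type u} [CommRing R] {S : Type u} [CommRing S] [Algebra R S]
  (p : Ideal R) [p.IsPrime] [IsLocalization.AtPrime S p]

/-- A regular sequence on `Y` in the maximal ideal of `R_𝔭` forces the vanishing of
`Ext^l(X, Y)`, for `l` less than its length, if `𝔭` annihilates `X`. -/
lemma extVanish_of_isWeaklyRegular [IsLocalRing S] {X Y : Type u} [AddCommGroup X] [Module R X]
    [AddCommGroup Y] [Module R Y] [Module S Y] [IsScalarTower R S Y]
    (hX : ∀ a ∈ p, ∀ x : X, a • x = 0) {rs : List S}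
    (hrs : ∀ r ∈ rs, r ∈ IsLocalRing.maximalIdeal S) (hY : IsWeaklyRegular Y rs) {l : ℕ}
    (hl : l < rs.length) : ExtVanish R X Y l := by
  induction rs generalizing Y l with
  | nil => simp at hl
  | cons r rs ih =>
    rw [isWeaklyRegular_cons_iff] at hY
    obtain ⟨⟨a, w⟩, haw⟩ := IsLocalization.surj p.primeCompl r
    change r * algebraMap R S w = algebraMap R S a at haw
    have ha : a ∈ p := by
      by_contra hap
      have hu := IsLocalization.map_units S (⟨a, hap⟩ : p.primeCompl)
      rw [← haw] at hu
      exact (IsLocalRing.mem_maximalIdeal r).1 (hrs r (by simp)) (isUnit_of_mul_isUnit_left hu)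
    have hw := IsLocalization.map_units S w
    have hrw : ∀ y : Y, algebraMap R S w • r • y = a • y := fun y => by
      rw [smul_smul, mul_comm, haw, algebraMap_smul]
    cases l with
    | zero =>
      rw [extVanish_zero_iff]
      intro f
      ext x
      have h1 : a • f x = 0 := by rw [← map_smul, hX a ha, map_zero]
      rw [← hrw, hw.smul_eq_zero] at h1
      exact hY.1.right_eq_zero_of_smul h1
    | succ l =>
      have h1 : ExtVanish R X (QuotSMulTop r Y) l :=
        ih (Y := QuotSMulTop r Y) (fun s hs => hrs s (by simp [hs])) hY.2 (by simpa using hl)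
      refine ExtVanish.of_quot_right (μ := smulHom R Y r) (g := quotHom R Y r) hY.1
        (exact_smulHom_quotHom r) (quotHom_surjective r) (hX a ha)
        (smulHom R Y (algebraMap R S w)) ?_ ?_ hrw h1
      · intro y y' hyy
        exact hw.smul_left_cancel.1 hyy
      · intro y
        obtain ⟨c, hc⟩ := hw.exists_right_inv
        refine ⟨c • y, ?_⟩
        change algebraMap R S w • c • y = y
        rw [smul_smul, hc, one_smul]

end DepthExt

section AssociatedPrimes

open TensorProduct

variable {R : Type u} [CommRing R] {S : Type u} [CommRing S] [Algebra R S]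
  (p : Ideal R) [p.IsPrime] [IsLocalization.AtPrime S p]

lemma ExtVanish.tensor_free {X F : Type u} [AddCommGroup X] [Module R X] [AddCommGroup F]
    [Module R F] [Module.Free R F] [Module.Finite R F] {l : ℕ} (h : ExtVanish R X S l) :
    ExtVanish R X (S ⊗[R] F) l := by
  let b := Module.Free.chooseBasis R F
  let e : F ≃ₗ[R] (Fin (Fintype.card (Module.Free.ChooseBasisIndex R F)) → R) :=
    b.equivFun.trans (LinearEquiv.funCongrLeft R R (Fintype.equivFin _).symm)
  exact (h.pi_right _).of_equiv_right ((TensorProduct.piScalarRight R R S _).symm.trans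
    (e.symm.lTensor S))

/-- For a presentation `P₁ → P₀ → X → 0` with transpose `T = coker(P₀^* → P₁^*)`, the module
`Ext^1(X, R)` embeds into `T`; if it vanishes, `0 → T → P₂^* → T' → 0` is exact, where `T'` is the
transpose of the first syzygy of `X`. So, by induction, if the depth of `T` at `𝔭` is more than
`i`, then `𝔭` is not associated to the first nonvanishing `Ext^{i+1}(X, R)`. -/
lemma notMem_associatedPrimes_ext [IsNoetherianRing R] {i : ℕ} {X P₀ P₁ : Type u}
    [AddCommGroup X] [Module R X] [AddCommGroup P₀] [Module R P₀] [AddCommGroup P₁] [Module R P₁]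
    [Module.Free R P₀] [Module.Finite R P₀] [Module.Free R P₁] [Module.Finite R P₁]
    {π₀ : P₀ →ₗ[R] X} (h₀ : Function.Surjective π₀) {π₁ : P₁ →ₗ[R] LinearMap.ker π₀}
    (h₁ : Function.Surjective π₁)
    (hT : ∀ l, l < i + 1 → ExtVanish R (R ⧸ p) (S ⊗[R] (Module.Dual R P₁ ⧸
      LinearMap.range ((LinearMap.ker π₀).subtype ∘ₗ π₁).dualMap)) l)
    (hS : ∀ l, l < i + 1 → ExtVanish R (R ⧸ p) S l)
    (hX : ∀ a, a < i → ExtVanish R X R (a + 1)) :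
    p ∉ associatedPrimes R (Ext.{u} (ModuleCat.of R X) (ModuleCat.of R R) (i + 1)) := by
  induction i generalizing X P₀ P₁ with
  | zero =>
    intro hp
    obtain ⟨-, e, he⟩ := isAssociatedPrime_iff.1 hp
    obtain ⟨δ, hδ, hδ'⟩ := exists_exact_ext_one (Y := R) (Submodule.subtype_injective _)
      (exact_subtype_ker π₀) h₀
    obtain ⟨g, rfl⟩ := hδ e
    let I := LinearMap.range ((LinearMap.ker π₀).subtype ∘ₗ π₁).dualMap
    -- The image of `e` under the embedding of `Ext^1(X, R)` into the transpose.
    let τ : Module.Dual R P₁ ⧸ I := Submodule.Quotient.mk (g ∘ₗ π₁)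
    have hτ : ∀ a : R, a • τ = 0 ↔ a ∈ p := by
      intro a
      have h1 : a ∈ p ↔ a • δ g = 0 := by
        rw [he]
        simp
      rw [h1, ← map_smul, hδ']
      change Submodule.Quotient.mk (a • (g ∘ₗ π₁)) = 0 ↔ _
      rw [Submodule.Quotient.mk_eq_zero]
      constructor
      · rintro ⟨k, hk⟩
        refine ⟨k, LinearMap.ext fun x => ?_⟩
        obtain ⟨y, rfl⟩ := h₁ x
        exact LinearMap.congr_fun hk y
      · rintro ⟨k, hk⟩
        exact ⟨k, LinearMap.ext fun y => LinearMap.congr_fun hk (π₁ y)⟩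
    let f : R ⧸ p →ₗ[R] S ⊗[R] (Module.Dual R P₁ ⧸ I) :=
      Submodule.liftQ p (LinearMap.toSpanSingleton R _ ((1 : S) ⊗ₜ[R] τ)) (by
        intro a ha
        rw [LinearMap.mem_ker, LinearMap.toSpanSingleton_apply, ← TensorProduct.tmul_smul,
          (hτ a).2 ha, TensorProduct.tmul_zero])
    have hf := extVanish_zero_iff.1 (hT 0 one_pos) f
    have h1 : (TensorProduct.mk R S (Module.Dual R P₁ ⧸ I) 1) τ = 0 := by
      have := LinearMap.congr_fun hf (Submodule.Quotient.mk 1)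
      exact (one_smul R _).symm.trans this
    obtain ⟨w, hw⟩ := (IsLocalizedModule.eq_zero_iff p.primeCompl _).1 h1
    exact w.2 ((hτ w).1 hw)
  | succ i ih =>
    have := IsLocalization.flat S p.primeCompl
    obtain ⟨k, π₂, h₂⟩ := exists_free_cover (R := R) (LinearMap.ker π₁)
    have hsh := extShift (Y := R) (Submodule.subtype_injective _) (exact_subtype_ker π₀) h₀ i
    rw [← LinearEquiv.AssociatedPrimes.eq hsh]
    let D₁ : Module.Dual R P₀ →ₗ[R] Module.Dual R P₁ :=
      ((LinearMap.ker π₀).subtype ∘ₗ π₁).dualMap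
    let D₂ : Module.Dual R P₁ →ₗ[R] Module.Dual R (Fin k → R) :=
      ((LinearMap.ker π₁).subtype ∘ₗ π₂).dualMap
    -- Exactness of `P₀^* → P₁^* → P₂^*` in the middle is `Ext^1(X, R) = 0`.
    have hker : LinearMap.ker D₂ = LinearMap.range D₁ := by
      ext φ
      constructor
      · intro hφ
        have h1 : φ ∘ₗ (LinearMap.ker π₁).subtype = 0 := by
          ext x
          obtain ⟨y, rfl⟩ := h₂ x
          exact LinearMap.congr_fun hφ y
        obtain ⟨g, rfl⟩ := (LinearMap.exact_lcomp_of_exact_of_surjective R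
          (exact_subtype_ker π₁) h₁ φ).1 h1
        obtain ⟨ψ, rfl⟩ := ExtVanish.exists_extension (Submodule.subtype_injective _)
          (exact_subtype_ker π₀) h₀ (hX 0 i.succ_pos) g
        exact ⟨ψ, rfl⟩
      · rintro ⟨ψ, rfl⟩
        refine LinearMap.mem_ker.2 (LinearMap.ext fun y => ?_)
        have : π₁ (π₂ y) = 0 := (π₂ y).2
        change ψ (π₁ (π₂ y)) = 0
        rw [this, Submodule.coe_zero, map_zero]
    let ι : (Module.Dual R P₁ ⧸ LinearMap.range D₁) →ₗ[R] Module.Dual R (Fin k → R) :=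
      (LinearMap.range D₁).liftQ D₂ hker.ge
    have hι : Function.Injective ι := by
      rw [← LinearMap.ker_eq_bot]
      exact Submodule.ker_liftQ_eq_bot _ _ _ hker.le
    have hex : Function.Exact ι (LinearMap.range D₂).mkQ := by
      rw [LinearMap.exact_iff, Submodule.ker_mkQ, Submodule.range_liftQ]
    refine ih h₁ h₂ (fun l hl => ?_) (fun l hl => hS l (by lia)) (fun a ha => ?_)
    · exact ExtVanish.quot_right (f := ι.lTensor S) (g := (LinearMap.range D₂).mkQ.lTensor S)
        (Module.Flat.lTensor_preserves_injective_linearMap ι hι)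
        (lTensor_exact S hex (Submodule.mkQ_surjective _))
        (LinearMap.lTensor_surjective S (Submodule.mkQ_surjective _))
        (hS l (by lia)).tensor_free (hT (l + 1) (by lia))
    · rw [extVanish_shift_iff (Submodule.subtype_injective _) (exact_subtype_ker π₀) h₀]
      exact hX (a + 1) (by lia)

end AssociatedPrimes

/-! ### Projective and Gorenstein dimension treated together -/

section HDim

variable {R : Type u} [CommRing R]

/-- `H-dim X ≤ m`. For both kinds of dimension this allows the zero module for every `m`. -/
def HDimLE (H : HomDimKind) (m : ℕ) (X : ModuleCat.{u} R) : Prop :=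
  match H with
  | .projective => HasProjectiveDimensionLT X (m + 1)
  | .gorenstein => GDimLE m X

variable {H : HomDimKind} {m k : ℕ}
variable {A B C : Type u} [AddCommGroup A] [Module R A] [AddCommGroup B] [Module R B]
  [AddCommGroup C] [Module R C]

lemma HDimLE.of_equiv (e : A ≃ₗ[R] B) (h : HDimLE H m (ModuleCat.of R A)) :
    HDimLE H m (ModuleCat.of R B) := by
  cases H with
  | projective =>
    have : HasProjectiveDimensionLT (ModuleCat.of R A) (m + 1) := h
    exact hasProjectiveDimensionLT_of_iso e.toModuleIso (m + 1)
  | gorenstein => exact GDimLE.of_equiv e h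

lemma HDimLE.hDim_le {M : ModuleCat.{u} R} (h : HDimLE H m M) :
    hDim H M ≤ ((m : ℕ∞) : WithBot ℕ∞) := by
  cases H with
  | projective => exact (projectiveDimension_le_iff M m).2 h
  | gorenstein => exact GDimLE.gorensteinDimension_le h

lemma exists_hDimLE_of_hDim_lt_top [IsNoetherianRing R] {M : ModuleCat.{u} R} (h : hDim H M < ⊤) :
    ∃ m, HDimLE H m M := by
  cases H with
  | projective =>
    obtain ⟨m, hm⟩ := (projectiveDimension_ne_top_iff M).1 h.ne
    exact ⟨m, hm⟩
  | gorenstein => exact exists_gDimLE_of_gorensteinDimension_lt_top h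

lemma HDimLE.mono [IsNoetherianRing R] (hmk : m ≤ k) {X : ModuleCat.{u} R} (h : HDimLE H m X) :
    HDimLE H k X := by
  cases H with
  | projective =>
    have : HasProjectiveDimensionLT X (m + 1) := h
    exact hasProjectiveDimensionLT_of_ge X (m + 1) (k + 1) (by lia)
  | gorenstein => exact GDimLE.mono hmk h

section

variable {f : A →ₗ[R] B} {g : B →ₗ[R] C} (hf : Function.Injective f)
    (h : Function.Exact f g) (hg : Function.Surjective g)
include hf h hg

lemma HDimLE.extension (hA : HDimLE H m (ModuleCat.of R A))
    (hC : HDimLE H m (ModuleCat.of R C)) : HDimLE H m (ModuleCat.of R B) := by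
  cases H with
  | projective =>
    exact (sesComplex_shortExact hf h hg).hasProjectiveDimensionLT_X₂ (m + 1) hA hC
  | gorenstein => exact GDimLE.extension hf h hg hA hC

lemma HDimLE.of_cover [IsNoetherianRing R] [Module.Finite R B] [Module.Projective R B]
    (hA : HDimLE H m (ModuleCat.of R A)) : HDimLE H (m + 1) (ModuleCat.of R C) := by
  cases H with
  | projective =>
    have hB : Projective (ModuleCat.of R B) := (IsProjective.iff_projective B).1 inferInstance
    exact ((sesComplex_shortExact hf h hg).hasProjectiveDimensionLT_X₃_iff m hB).2 hA
  | gorenstein =>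
    refine GDimLE.of_cover isTotallyReflexive_of_projective hg (GDimLE.of_equiv ?_ hA)
    exact (LinearEquiv.ofInjective f hf).trans
      (LinearEquiv.ofEq _ _ (LinearMap.exact_iff.1 h).symm)

end

lemma hasProjectiveDimensionLT_ker {m : ℕ} [Module.Projective R B] {g : B →ₗ[R] C}
    (hg : Function.Surjective g) (h : HasProjectiveDimensionLT (ModuleCat.of R C) (m + 2)) :
    HasProjectiveDimensionLT (ModuleCat.of R (LinearMap.ker g)) (m + 1) := by
  have hB : Projective (ModuleCat.of R B) := (IsProjective.iff_projective B).1 inferInstance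
  exact ((sesComplex_shortExact (Submodule.subtype_injective _) (exact_subtype_ker g)
    hg).hasProjectiveDimensionLT_X₃_iff m hB).1 h

variable [IsNoetherianRing R]

lemma HDimLE.gDimLE [Module.Finite R A] (h : HDimLE H m (ModuleCat.of R A)) :
    GDimLE m (ModuleCat.of R A) := by
  cases H with
  | projective =>
    change HasProjectiveDimensionLT _ _ at h
    induction m generalizing A with
    | zero =>
      have : Module.Projective R A :=
        (IsProjective.iff_projective A).2 (projective_iff_hasProjectiveDimensionLT_one.2 h)
      exact isTotallyReflexive_of_projective
    | succ m ih =>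
      obtain ⟨n, f, hf⟩ := exists_free_cover (R := R) A
      exact GDimLE.of_cover isTotallyReflexive_of_projective hf
        (ih (hasProjectiveDimensionLT_ker hf h))
  | gorenstein => exact h

/-- A finitely generated module of finite projective dimension is projective if its `Ext` into
`R` vanishes in positive degrees: its first syzygy is projective by induction, and then the
extension by the first syzygy splits. -/
lemma projective_of_hasProjectiveDimensionLT {m : ℕ} [Module.Finite R A]
    (h : HasProjectiveDimensionLT (ModuleCat.of R A) (m + 1))
    (hA : ∀ n, ExtVanish R A R (n + 1)) : Module.Projective R A := by
  induction m generalizing A with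
  | zero =>
    exact (IsProjective.iff_projective A).2 (projective_iff_hasProjectiveDimensionLT_one.2 h)
  | succ m ih =>
    obtain ⟨n, f, hf⟩ := exists_free_cover (R := R) A
    have hi := Submodule.subtype_injective (LinearMap.ker f)
    have hex := exact_subtype_ker f
    have hK : Module.Projective R (LinearMap.ker f) :=
      ih (hasProjectiveDimensionLT_ker hf h) fun n =>
        (extVanish_shift_iff hi hex hf n).2 (hA (n + 1))
    obtain ⟨a, q, hq⟩ := exists_free_cover (R := R) (LinearMap.ker f)
    -- The syzygy `ker f` is a direct summand of `R^a`, via a section of `q`.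
    obtain ⟨σ, hσ⟩ := Module.projective_lifting_property q LinearMap.id hq
    have hpi : ExtVanish R A (Fin a → R) 1 := (hA 0).pi_right a
    obtain ⟨ψ, hψ⟩ := hpi.exists_extension hi hex hf σ
    have hr : (q ∘ₗ ψ) ∘ₗ (LinearMap.ker f).subtype = LinearMap.id := by
      rw [LinearMap.comp_assoc, hψ, hσ]
    have hsplit := hex.split_tfae'.out 1 0
    obtain ⟨-, l, hl⟩ := hsplit.1 ⟨hf, _, hr⟩
    exact Module.Projective.of_split l f hl

end HDim

/-! ### Modules whose transpose has finite dimension -/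

section Transpose

open TensorProduct

variable {R : Type u} [CommRing R]

lemma smul_quotient_eq_zero (p : Ideal R) (a : R) (ha : a ∈ p) (x : R ⧸ p) : a • x = 0 := by
  obtain ⟨y, rfl⟩ := Ideal.Quotient.mk_surjective x
  exact Ideal.Quotient.eq_zero_iff_mem.2 (p.mul_mem_right y ha)

variable (R) in
/-- The cohomological form of `(S̃ₙ)`: for every prime `𝔭`, the depth of `M_𝔭` is at least
`min {n, depth R_𝔭}`, where depth is measured by the vanishing of `Ext_R(R/𝔭, -)`. -/
def ExtSTilde (n : ℕ) (M : Type u) [AddCommGroup M] [Module R M] : Prop :=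
  ∀ (p : Ideal R) [p.IsPrime], ∀ l < n,
    (l : ℕ∞) < depth (Localization.AtPrime p) (Localization.AtPrime p) →
      ExtVanish R (R ⧸ p) (Localization.AtPrime p ⊗[R] M) l

lemma extVanish_of_lt_depth (p : Ideal R) [p.IsPrime] {Y : Type u} [AddCommGroup Y] [Module R Y]
    [Module (Localization.AtPrime p) Y] [IsScalarTower R (Localization.AtPrime p) Y] {l : ℕ}
    (hl : (l : ℕ∞) < depth (Localization.AtPrime p) Y) : ExtVanish R (R ⧸ p) Y l := by
  obtain h | ⟨rs, h1, h2, h3⟩ := exists_isRegular_of_lt_depth hl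
  · exact extVanish_of_subsingleton_right l
  · exact extVanish_of_isWeaklyRegular p (smul_quotient_eq_zero p) h1 h2.toIsWeaklyRegular h3

lemma SatisfiesSTilde.extSTilde {n : ℕ} {M : Type u} [AddCommGroup M] [Module R M]
    (h : SatisfiesSTilde R M n) : ExtSTilde R n M := by
  intro p _ l hl hlp
  have h1 : ExtVanish R (R ⧸ p) (LocalizedModule p.primeCompl M) l :=
    extVanish_of_lt_depth p (lt_of_lt_of_le (lt_min (by exact_mod_cast hl) hlp) (h p))
  exact h1.of_equiv_right
    ((LocalizedModule.equivTensorProduct p.primeCompl M).restrictScalars R)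

lemma ExtSTilde.kernel {n : ℕ} {F M : Type u} [AddCommGroup F] [Module R F] [Module.Free R F]
    [Module.Finite R F] [AddCommGroup M] [Module R M] {f : F →ₗ[R] M}
    (hf : Function.Surjective f) (h : ExtSTilde R n M) :
    ExtSTilde R (n + 1) (LinearMap.ker f) := by
  intro p _ l hl hlp
  have hi : Function.Injective ((LinearMap.ker f).subtype.lTensor (Localization.AtPrime p)) :=
    Module.Flat.lTensor_preserves_injective_linearMap _ (Submodule.subtype_injective _)
  have hF : ExtVanish R (R ⧸ p) (Localization.AtPrime p ⊗[R] F) l :=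
    (extVanish_of_lt_depth p hlp).tensor_free
  cases l with
  | zero =>
    rw [extVanish_zero_iff] at hF ⊢
    intro φ
    refine LinearMap.ext fun x => ?_
    exact hi ((LinearMap.congr_fun (hF (LinearMap.lTensor _ (LinearMap.ker f).subtype ∘ₗ φ))
      x).trans (map_zero _).symm)
  | succ l =>
    refine ExtVanish.sub_right hi (lTensor_exact _ (exact_subtype_ker f) hf)
      (LinearMap.lTensor_surjective _ hf) (h p l (by lia) (lt_of_le_of_lt ?_ hlp)) hF
    exact_mod_cast l.le_succ

/-- The transpose of the transpose of `M`, for a presentation by reflexive modules, is `M`. -/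
lemma quotient_range_dualMap_dualMap_equiv {P₀ P₁ M : Type u} [AddCommGroup P₀] [Module R P₀]
    [AddCommGroup P₁] [Module R P₁] [AddCommGroup M] [Module R M] [Module.IsReflexive R P₀]
    [Module.IsReflexive R P₁] {d : P₁ →ₗ[R] P₀} {f : P₀ →ₗ[R] M} (h : Function.Exact d f)
    (hf : Function.Surjective f) :
    Nonempty (M ≃ₗ[R] (Module.Dual R (Module.Dual R P₀) ⧸ LinearMap.range d.dualMap.dualMap)) := by
  refine ⟨(f.quotKerEquivOfSurjective hf).symm.trans
    (Submodule.Quotient.equiv _ _ (Module.evalEquiv R P₀) ?_)⟩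
  rw [LinearMap.exact_iff.1 h]
  ext α
  constructor
  · rintro ⟨_, ⟨x, rfl⟩, rfl⟩
    exact ⟨Module.Dual.eval R P₁ x, rfl⟩
  · rintro ⟨β, rfl⟩
    obtain ⟨x, rfl⟩ := (Module.evalEquiv R P₁).surjective β
    exact ⟨d x, ⟨x, rfl⟩, rfl⟩

/-- If the transpose `C` of `M` has finite Gorenstein dimension, then a nonzero `Ext^j(C, R)`,
`j > 0`, has an associated prime `𝔭` with `j ≤ depth R` and `j ≤ depth R_𝔭`, by the
Auslander–Bridger inequality over `R` and over `R_𝔭`. For the least such `j` the depth condition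
on `M`, the transpose of `C`, excludes this. -/
lemma extVanish_transpose [IsNoetherianRing R] [IsLocalRing R] {P₀ P₁ M : Type u}
    [AddCommGroup P₀] [Module R P₀] [Module.Free R P₀] [Module.Finite R P₀]
    [AddCommGroup P₁] [Module R P₁] [Module.Free R P₁] [Module.Finite R P₁]
    [AddCommGroup M] [Module R M] {d : P₁ →ₗ[R] P₀} {f : P₀ →ₗ[R] M} (h : Function.Exact d f)
    (hf : Function.Surjective f) {t m : ℕ} (ht : depth R R = t) (hM : ExtSTilde R t M)
    (hC : GDimLE m (ModuleCat.of R (Module.Dual R P₁ ⧸ LinearMap.range d.dualMap))) (n : ℕ) :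
    ExtVanish R (Module.Dual R P₁ ⧸ LinearMap.range d.dualMap) R (n + 1) := by
  induction n using Nat.strong_induction_on with
  | _ n ih =>
  by_contra hne
  have hnt : Nontrivial (Ext.{u} (ModuleCat.of R (Module.Dual R P₁ ⧸ LinearMap.range d.dualMap))
    (ModuleCat.of R R) (n + 1)) := not_subsingleton_iff_nontrivial.1 hne
  obtain ⟨p, hp⟩ := associatedPrimes.nonempty R (Ext.{u} (ModuleCat.of R
    (Module.Dual R P₁ ⧸ LinearMap.range d.dualMap)) (ModuleCat.of R R) (n + 1))
  obtain ⟨hprime, e, he⟩ := isAssociatedPrime_iff.1 hp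
  -- Auslander–Bridger over `R`.
  have hnt : n < t := by
    by_contra hlt
    obtain ⟨rs, hrs, hle⟩ := exists_isMaximalRegular R
    rw [ht, Nat.cast_le] at hle
    have : IsLocalization (⊥ : Submonoid R) R := IsLocalization.self bot_le
    exact hne (hC.extVanish_of_length_lt hrs (by lia) ⊥)
  -- Auslander–Bridger over `R_𝔭`: its failure would make an element outside `𝔭 = ann e` kill `e`.
  have hnp : (n : ℕ∞) < depth (Localization.AtPrime p) (Localization.AtPrime p) := by
    by_contra hlt
    obtain ⟨rs, hrs, hle⟩ := exists_isMaximalRegular (Localization.AtPrime p)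
    have hle' : (rs.length : ℕ∞) ≤ n := hle.trans (not_lt.1 hlt)
    rw [Nat.cast_le] at hle'
    obtain ⟨w, hw, hwe⟩ := exists_smul_ext_eq_zero p.primeCompl
      (hC.extVanish_of_length_lt hrs (j := n) (by lia) p.primeCompl) e
    refine hw ?_
    rw [he]
    simpa using hwe
  have hlt : ∀ l, l < n + 1 →
      (l : ℕ∞) < depth (Localization.AtPrime p) (Localization.AtPrime p) := fun l hl =>
    lt_of_le_of_lt (by exact_mod_cast Nat.lt_succ_iff.1 hl) hnp
  let I := LinearMap.range d.dualMap
  let π₁ : Module.Dual R P₀ →ₗ[R] LinearMap.ker I.mkQ :=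
    d.dualMap.codRestrict _ fun x => by
      rw [Submodule.ker_mkQ]
      exact ⟨x, rfl⟩
  have h₁ : Function.Surjective π₁ := by
    rintro ⟨y, hy⟩
    rw [Submodule.ker_mkQ] at hy
    obtain ⟨x, rfl⟩ := hy
    exact ⟨x, rfl⟩
  -- `P₁^*` and `P₀^*` are the start of a free resolution of the transpose.
  obtain ⟨E⟩ := quotient_range_dualMap_dualMap_equiv h hf
  refine notMem_associatedPrimes_ext (S := Localization.AtPrime p) p (Submodule.mkQ_surjective I)
    h₁ (fun l hl => ?_) (fun l hl => extVanish_of_lt_depth p (hlt l hl)) ih hp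
  exact (hM p l (by lia) (hlt l hl)).of_equiv_right (E.lTensor (Localization.AtPrime p))

section Factorization

variable {P₀ P₁ M I C : Type u} [AddCommGroup P₀] [Module R P₀] [AddCommGroup P₁] [Module R P₁]
  [AddCommGroup M] [Module R M] [AddCommGroup I] [Module R I] [AddCommGroup C] [Module R C]
  {d : P₁ →ₗ[R] P₀} {f : P₀ →ₗ[R] M} {u : Module.Dual R P₀ →ₗ[R] I}
  {v : I →ₗ[R] Module.Dual R P₁} {w : Module.Dual R P₁ →ₗ[R] C}

/-- For a presentation `d : P₁ → P₀` of `M`, with `d^*` factored as `v ∘ u` through `I`, this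
derives the reflexivity of `M` from exactness of the dual of `0 → M^* → P₀^* → I → 0` and
surjectivity of the dual of `v : I → P₁^*`. -/
lemma bijective_dual_eval_of_factorization [Module.IsReflexive R P₀] [Module.IsReflexive R P₁]
    (h : Function.Exact d f) (hf : Function.Surjective f) (huv : v ∘ₗ u = d.dualMap)
    (hu : Function.Exact u.dualMap f.dualMap.dualMap)
    (hfu : Function.Surjective f.dualMap.dualMap) (hv : Function.Surjective v.dualMap) :
    Function.Bijective (Module.Dual.eval R M) := by
  constructor
  · rw [← LinearMap.ker_eq_bot, LinearMap.ker_eq_bot']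
    intro x hx
    obtain ⟨y, rfl⟩ := hf x
    -- Evaluation at `y` kills `M^*`, so it comes from a functional on `I`, which extends to
    -- `P₁^*`, so that `y` is in the image of `P₁`.
    obtain ⟨γ, hγ⟩ := (hu (Module.Dual.eval R P₀ y)).1 hx
    obtain ⟨β, rfl⟩ := hv γ
    obtain ⟨z, rfl⟩ := (Module.bijective_dual_eval R P₁).2 β
    refine (h y).2 ⟨z, (Module.bijective_dual_eval R P₀).1 ?_⟩
    rw [← hγ]
    ext φ
    exact (LinearMap.congr_fun (LinearMap.congr_fun huv φ) z).symm
  · intro α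
    obtain ⟨β, rfl⟩ := hfu α
    obtain ⟨y, rfl⟩ := (Module.bijective_dual_eval R P₀).2 β
    exact ⟨f y, rfl⟩

/-- If the transpose `C` of `M` is totally reflexive, then so are `M` and `M^*`. -/
lemma isTotallyReflexive_of_transpose [IsNoetherianRing R] [Module.Projective R P₀]
    [Module.Finite R P₀] [Module.Projective R P₁] [Module.Finite R P₁]
    (h : Function.Exact d f) (hf : Function.Surjective f) (huv : v ∘ₗ u = d.dualMap)
    (hu : Function.Surjective u) (hv : Function.Injective v) (hvw : Function.Exact v w)
    (hw : Function.Surjective w) (hC : IsTotallyReflexive (ModuleCat.of R C)) :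
    IsTotallyReflexive (ModuleCat.of R M) ∧
      IsTotallyReflexive (ModuleCat.of R (Module.Dual R M)) := by
  have hMf : Module.Finite R M := Module.Finite.of_surjective f hf
  have hI : IsTotallyReflexive (ModuleCat.of R I) :=
    IsTotallyReflexive.kernel hv hvw hw (Module.Finite.of_surjective u hu)
      isTotallyReflexive_of_projective hC
  have e : Function.Exact f.dualMap u := by
    intro φ
    rw [← exact_dualMap h hf φ, ← huv]
    exact ((injective_iff_map_eq_zero' v).1 hv (u φ)).symm
  have i := LinearMap.dualMap_injective_of_surjective hf
  have hD : IsTotallyReflexive (ModuleCat.of R (Module.Dual R M)) :=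
    IsTotallyReflexive.kernel i e hu inferInstance isTotallyReflexive_of_projective hI
  obtain ⟨-, -, i3, -⟩ := isTotallyReflexive_iff.1 hI
  obtain ⟨-, -, c3, -⟩ := isTotallyReflexive_iff.1 hC
  obtain ⟨-, -, d3, d4⟩ := isTotallyReflexive_iff.1 hD
  have hbij : Function.Bijective (Module.Dual.eval R M) :=
    bijective_dual_eval_of_factorization h hf huv (exact_dualMap e hu)
      (dualMap_surjective_of_extVanish i e hu (i3 0))
      (dualMap_surjective_of_extVanish hv hvw hw (c3 0))
  exact ⟨isTotallyReflexive_iff.2 ⟨hMf, hbij,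
    fun n => (d4 n).of_equiv_left (LinearEquiv.ofBijective _ hbij).symm, d3⟩, hD⟩

end Factorization

end Transpose

/-! ### Descending induction on the depth condition -/

section Induction

lemma satisfiesSTilde_zero (R : Type u) [CommRing R] (M : Type u) [AddCommGroup M] [Module R M] :
    SatisfiesSTilde R M 0 := fun p _ => by simp

variable {R : Type u} [CommRing R] [IsNoetherianRing R] {H : HomDimKind}

/-- The case `S = R` of `GDimLE.isRelTotallyReflexive`. -/
lemma GDimLE.isTotallyReflexive_of_extVanish {m : ℕ} {A : Type u} [AddCommGroup A] [Module R A]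
    (h : GDimLE m (ModuleCat.of R A)) (hA : ∀ n, ExtVanish R A R (n + 1)) :
    IsTotallyReflexive (ModuleCat.of R A) := by
  have : IsLocalization (⊥ : Submonoid R) R := IsLocalization.self bot_le
  obtain ⟨h1, h2, h3, h4, h5⟩ := h.isRelTotallyReflexive (W := (⊥ : Submonoid R)) hA
  refine isTotallyReflexive_iff.2 ⟨h1, ⟨?_, fun φ => ?_⟩, h2, h3⟩
  · rw [← LinearMap.ker_eq_bot, LinearMap.ker_eq_bot']
    intro x hx
    obtain ⟨w, hw, hwx⟩ := h5 x fun f => LinearMap.congr_fun hx f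
    rwa [Submonoid.mem_bot.1 hw, one_smul] at hwx
  · obtain ⟨x, w, hw, hwx⟩ := h4 φ
    refine ⟨x, LinearMap.ext fun f => ?_⟩
    have := hwx f
    rw [Submonoid.mem_bot.1 hw, map_one, one_mul] at this
    exact this.symm

lemma HDimLE.of_isTotallyReflexive_dual {m : ℕ} {M : Type u} [AddCommGroup M] [Module R M]
    (hM : IsTotallyReflexive (ModuleCat.of R M))
    (hD : IsTotallyReflexive (ModuleCat.of R (Module.Dual R M)))
    (h : HDimLE H m (ModuleCat.of R (Module.Dual R M))) : HDimLE H 0 (ModuleCat.of R M) := by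
  cases H with
  | projective =>
    obtain ⟨d1, -, d3, -⟩ := isTotallyReflexive_iff.1 hD
    have : Module.Projective R (Module.Dual R M) := projective_of_hasProjectiveDimensionLT h d3
    have : Module.IsReflexive R M := hM.reflexive
    have : Module.Projective R M := .of_equiv (Module.evalEquiv R M).symm
    exact projective_iff_hasProjectiveDimensionLT_one.1
      ((IsProjective.iff_projective M).1 inferInstance)
  | gorenstein => exact hM

lemma HDimLE.range_dualMap {m : ℕ} {K P₀ M : Type u} [AddCommGroup P₀] [Module R P₀]
    [Module.Projective R P₀] [Module.Finite R P₀] [AddCommGroup K] [Module R K] [AddCommGroup M]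
    [Module R M] {d : K →ₗ[R] P₀} {f : P₀ →ₗ[R] M} (h : Function.Exact d f)
    (hf : Function.Surjective f) (hM : HDimLE H m (ModuleCat.of R (Module.Dual R M))) :
    HDimLE H (m + 1) (ModuleCat.of R (LinearMap.range d.dualMap)) := by
  refine HDimLE.of_cover (f := f.dualMap) (g := d.dualMap.rangeRestrict)
    (LinearMap.dualMap_injective_of_surjective hf) (fun φ => ?_)
    d.dualMap.surjective_rangeRestrict hM
  rw [← exact_dualMap h hf φ]
  exact Subtype.ext_iff

/-- The linear equivalence `Ext^0(M, R) ≃ M^*`. -/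
noncomputable def extZeroEquiv (M : Type u) [AddCommGroup M] [Module R M] :
    Ext.{u} (ModuleCat.of R M) (ModuleCat.of R R) 0 ≃ₗ[R] Module.Dual R M :=
  Ext.linearEquiv₀.trans ModuleCat.homLinearEquiv

variable [IsLocalRing R]

/-- The bound `H-dim M ≤ s` for `s = depth R - n`. Passing to a syzygy lowers `s` by one; for
`s = 0` the transpose of `M` is shown to be totally reflexive. -/
lemma hDimLE_of_extSTilde (s n : ℕ) (M : Type u) [AddCommGroup M] [Module R M]
    [Module.Finite R M] (ht : depth R R = (n + s : ℕ)) (hM : ExtSTilde R n M)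
    (hE : ∀ i ≤ s, ∃ m, HDimLE H m
      (ModuleCat.of R (Ext.{u} (ModuleCat.of R M) (ModuleCat.of R R) i))) :
    HDimLE H s (ModuleCat.of R M) := by
  obtain ⟨m₀, h₀⟩ := hE 0 s.zero_le
  replace h₀ : HDimLE H m₀ (ModuleCat.of R (Module.Dual R M)) := h₀.of_equiv (extZeroEquiv M)
  obtain ⟨a, f, hf⟩ := exists_free_cover (R := R) M
  induction s generalizing n M m₀ a with
  | zero =>
    obtain ⟨b, q, hq⟩ := exists_free_cover (R := R) (LinearMap.ker f)
    let d : (Fin b → R) →ₗ[R] (Fin a → R) := (LinearMap.ker f).subtype ∘ₗ q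
    have hd : Function.Exact d f := by
      rw [LinearMap.exact_iff, LinearMap.range_comp, LinearMap.range_eq_top.2 hq,
        Submodule.map_top, Submodule.range_subtype]
    have hC : HDimLE H (m₀ + 2)
        (ModuleCat.of R (Module.Dual R (Fin b → R) ⧸ LinearMap.range d.dualMap)) :=
      HDimLE.of_cover (Submodule.subtype_injective _) (LinearMap.exact_subtype_mkQ _)
        (Submodule.mkQ_surjective _) (HDimLE.range_dualMap hd hf h₀)
    obtain ⟨h1, h2⟩ := isTotallyReflexive_of_transpose
      (I := LinearMap.range d.dualMap) hd hf
      (u := d.dualMap.rangeRestrict) (v := (LinearMap.range d.dualMap).subtype)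
      (w := (LinearMap.range d.dualMap).mkQ) rfl
      d.dualMap.surjective_rangeRestrict (Submodule.subtype_injective _)
      (LinearMap.exact_subtype_mkQ _) (Submodule.mkQ_surjective _)
      (hC.gDimLE.isTotallyReflexive_of_extVanish
        (extVanish_transpose hd hf ht hM hC.gDimLE))
    exact h₀.of_isTotallyReflexive_dual h1 h2
  | succ s ih =>
    have hi := Submodule.subtype_injective (LinearMap.ker f)
    have hex := exact_subtype_ker f
    obtain ⟨m₁, h₁⟩ := hE 1 (by lia)
    obtain ⟨δ, hδ, hδ'⟩ := exists_exact_ext_one (Y := R) hi hex hf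
    have hK : HDimLE H (max (m₀ + 1) m₁) (ModuleCat.of R (Module.Dual R (LinearMap.ker f))) := by
      refine HDimLE.extension (Submodule.subtype_injective _) (fun φ => ?_) hδ
        ((HDimLE.range_dualMap hex hf h₀).mono (le_max_left _ _)) (h₁.mono (le_max_right _ _))
      rw [hδ', Submodule.coe_subtype, Subtype.range_coe]
      exact Iff.rfl
    obtain ⟨b, q, hq⟩ := exists_free_cover (R := R) (LinearMap.ker f)
    refine HDimLE.of_cover hi hex hf (ih (n + 1) (LinearMap.ker f) (by rw [ht]; congr 1; lia)
      (hM.kernel hf) (fun i his => ?_) _ hK b q hq)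
    cases i with
    | zero => exact ⟨_, hK.of_equiv (extZeroEquiv _).symm⟩
    | succ i =>
      obtain ⟨m, hm⟩ := hE (i + 2) (by lia)
      exact ⟨m, hm.of_equiv (extShift hi hex hf i).symm⟩

lemma SatisfiesSTilde.hDim_le {n : ℕ} {M : ModuleCat.{u} R} [Module.Finite R M]
    (hn : (n : ℕ∞) ≤ depth R R) (hM : SatisfiesSTilde R M n)
    (hE : ∀ i : ℕ, (i : ℕ∞) ≤ depth R R - n → hDim H (extRing M i) < ⊤) :
    hDim H M ≤ ((depth R R - n : ℕ∞) : WithBot ℕ∞) := by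
  obtain ⟨t, ht⟩ := ENat.ne_top_iff_exists.1 (depth_ne_top R)
  rw [← ht, Nat.cast_le] at hn
  obtain ⟨s, rfl⟩ := Nat.exists_eq_add_of_le hn
  have hs : depth R R - n = (s : ℕ∞) := by
    rw [← ht, ← ENat.natCast_sub, Nat.add_sub_cancel_left]
  rw [hs] at hE ⊢
  exact (hDimLE_of_extSTilde s n M ht.symm hM.extSTilde fun i hi =>
    exists_hDimLE_of_hDim_lt_top (hE i (by exact_mod_cast hi))).hDim_le

end Induction

end ExtHomDim

theorem mainTheorem8 (R : Type u) [CommRing R] [IsNoetherianRing R] [IsLocalRing R]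
    (M : ModuleCat.{u} R) [Module.Finite R M] (H : ExtHomDim.HomDimKind) :
    (∀ n : ℕ, (n : ℕ∞) ≤ ExtHomDim.depth R R → ExtHomDim.SatisfiesSTilde R M n →
      (∀ i : ℕ, (i : ℕ∞) ≤ ExtHomDim.depth R R - n →
        ExtHomDim.hDim H (ExtHomDim.extRing M i) < ⊤) →
      ExtHomDim.hDim H M ≤ ((ExtHomDim.depth R R - n : ℕ∞) : WithBot ℕ∞)) ∧
    ((∀ i : ℕ, (i : ℕ∞) ≤ ExtHomDim.depth R R →
        ExtHomDim.hDim H (ExtHomDim.extRing M i) < ⊤) →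
      ExtHomDim.hDim H M < ⊤) := by
  refine ⟨fun n hn hM hE => hM.hDim_le hn hE, fun hE => ?_⟩
  refine ((ExtHomDim.satisfiesSTilde_zero R M).hDim_le (by simp) fun i hi =>
    hE i (hi.trans tsub_le_self)).trans_lt ?_
  obtain ⟨t, ht⟩ := ENat.ne_top_iff_exists.1 (ExtHomDim.depth_ne_top R)
  rw [← ht, ← ENat.natCast_sub]
  exact WithBot.coe_lt_coe.2 (ENat.natCast_lt_top _)
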